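/- **Setting.** Let $\sigma$ be a piecewise constant, right-continuous switching signal on $[t_0,\infty)$, $t_0\ge 0$, with values in a finite set $\mathcal P$ of modes and switching instants $t_0<t_1<t_2<\cdots\to\infty$; write $\sigma_k=\sigma(t_k)$ for the mode on $[t_k,t_{k+1})$. Mode $\phi$ has a digraph $\mathcal G_\phi$ without self-loops on $N_\phi\ge 2$ agents, with 0-1 adjacency matrix $[a_{ij}(\phi)]$ ($a_{ij}=1$ iff there is an edge from $j$ to $i$) and Laplacian $L_\phi=[l_{ij}(\phi)]$. Let $\mathcal P_s$ be the set of modes whose digraph contains a directed spanning tree, $\mathcal P_u=\mathcal P\setminus\mathcal P_s$. The signal is quasi-alternative: if $\sigma_k\in\mathcal P_u$ then $\sigma_{k+1}\in\mathcal P_s$. Let $S\in\mathbb R^{p\times p}$ ($p\geq 1$) have all eigenvalues with positive real part and let $\varrho>0$. The open multi-agent system is $$\dot\xi_i=S\xi_i-\varrho\sum_{j}a_{ij}(\sigma(t))(\xi_i-\xi_j),\quad i=1,\dots,N_{\sigma(t)},\qquad \tilde\xi(t_k^+)=\Xi_{\sigma_k,\sigma_{k-1}}\tilde\xi(t_k^-)+\Phi_k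 ,$$ where $\xi_i(t)\in\mathbb R^p$, $\tilde\xi$ stacks the $\xi_i$, $\Xi_{\phi,\hat\phi}$ is the 0-1 matrix got from the identity by removing the $p$-row blocks of agents that leave and inserting zero $p$-row blocks for agents that join (a replacement combines both, or leaves the identity unchanged), and $\Phi_k$ is an arbitrary jump vector. With $\delta_i=\xi_i-\xi_{N_{\sigma(t)}}$, $i<N_{\sigma(t)}$, stacked to $\tilde\delta=\Upsilon\tilde\xi$, let $Z_\phi=[l_{ij}-l_{N_\phi j}]_{i,j<N_\phi}$, let $A_\phi=I\otimes S-\varrho Z_\phi\otimes I_p$, let $\tilde\Xi_{\phi,\hat\phi}$ be $\Xi_{\phi,\hat\phi}$ without its last $p$ rows and columns, and let $$\tilde\Phi_k=\Upsilon\Phi_k+(\Upsilon\,\Xi_{\sigma_k,\sigma_{k-1}}-\tilde\Xi_{\sigma_k,\sigma_{k-1}}\Upsilon)\,\tilde\xi(t_k^-).$$ **Parameters.** For each $\phi$ let $\gamma_\phi>\max_j\mathrm{Re}\,\lambda_j(A_\phi)$, with $\gamma_\phi<0$ if $\phi\in\mathcal P_s$, and let $\tilde P_\phi>0$ satisfy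 $A_\phi^T\tilde P_\phi+\tilde P_\phi A_\phi-2\gamma_\phi\tilde P_\phi=-I$. Put $\tilde\gamma_\phi=-1/\lambda_{\max}(\tilde P_\phi)+2\gamma_\phi$ for $\phi\in\mathcal P_s$ and $\tilde\gamma_\phi=2\gamma_\phi$ for $\phi\in\mathcal P_u$. Let $\eta_0>0$ and $\chi_{\phi,\hat\phi}\in(0,1)$ for $\phi\in\mathcal P_u$. For a number $U\ge1$ put $R_{\phi,\hat\phi}=2\lambda_{\max}(\tilde P_\phi)U/\lambda_{\min}(\tilde P_{\hat\phi})$ and define $\eta_k$, $k\ge1$, by: $\eta_k=\chi_{\sigma_k,\sigma_{k-1}}\eta_{k-1}/R_{\sigma_k,\sigma_{k-1}}$ if $\sigma_k\in\mathcal P_u$ and $R_{\sigma_k,\sigma_{k-1}}\ge1$; $\eta_k=R_{\sigma_{k-1},\sigma_{k-2}}\eta_{k-1}/\chi_{\sigma_{k-1},\sigma_{k-2}}$ if $k>1$, $\sigma_k\in\mathcal P_s$, $\sigma_{k-1}\in\mathcal P_u$ and $R_{\sigma_{k-1},\sigma_{k-2}}\ge1$; $\eta_k=\eta_{k-1}$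 otherwise. For every pair $(\phi,\hat\phi)$ such that a switching from $\hat\phi$ to $\phi$ occurs let $$\Omega_{\phi,\hat\phi}=\max_{k:\ \sigma_k=\phi,\ \sigma_{k-1}=\hat\phi}\ \frac{2\eta_k\lambda_{\max}(\tilde P_\phi)}{\eta_{k-1}\lambda_{\min}(\tilde P_{\hat\phi})}\,U .$$ **Dwell-time conditions.** Let $N_{\phi,\hat\phi}(a,b)$ be the number of switchings from $\hat\phi$ to $\phi$ on $[a,b)$ and $T_{\phi,\hat\phi}(a,b)$ the total time in $[a,b)$ during which $\phi$ is active with precedent mode $\hat\phi$. The *TDADT conditions* hold with constants $\tau_{\phi,\hat\phi}>0$ if for every pair $(\phi,\hat\phi)$ for which a switching occurs there is $\hat N_{\phi,\hat\phi}\in\mathbb R$ such that, for all $t>t_0$, - if $\phi\in\mathcal P_s$: $N_{\phi,\hat\phi}(t_0,t)\le\hat N_{\phi,\hat\phi}+T_{\phi,\hat\phi}(t_0,t)/\tau_{\phi,\hat\phi}$, and $\tau_{\phi,\hat\phi}\ge-\ln\Omega_{\phi,\hat\phi}/\tilde\gamma_\phi$; - if $\phi\in\mathcal P_u$: $N_{\phi,\hat\phi}(t_0,t)\ge\hat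 N_{\phi,\hat\phi}+T_{\phi,\hat\phi}(t_0,t)/\tau_{\phi,\hat\phi}$, and $\tau_{\phi,\hat\phi}\le-\ln\Omega_{\phi,\hat\phi}/\tilde\gamma_\phi$. The *piecewise TDADT conditions* hold if for all $1\le j\le k$ and all $(\phi,\hat\phi)$ with $N_{\phi,\hat\phi}(t_j,t_{k+1})\ne0$ the quotient $T_{\phi,\hat\phi}(t_j,t_{k+1})/N_{\phi,\hat\phi}(t_j,t_{k+1})$ is $\ge-\ln\Omega_{\phi,\hat\phi}/\tilde\gamma_\phi$ if $\phi\in\mathcal P_s$, and $\le-\ln\Omega_{\phi,\hat\phi}/\tilde\gamma_\phi$ if $\phi\in\mathcal P_u$. **Theorem.** 1. Along every trajectory, the disagreement vector is a trajectory of the multi-dimensional switched system (MDSS) $\dot{\tilde\delta}=A_{\sigma(t)}\tilde\delta$, $\tilde\delta(t_k^+)=\tilde\Xi_{\sigma_k,\sigma_{k-1}}\tilde\delta(t_k^-)+\tilde\Phi_k$, with 0-1 matrices $\tilde\Xi_{\phi,\hat\phi}$. 2. (State-independent jumps.) Let $U=\max(1,\max_{\phi,\hat\phi}\|\tilde\Xi_{\phi,\hat\phi}\|^2)$,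 and suppose that the TDADT and the piecewise TDADT conditions hold. Then practical consensus is achieved: for every $\bar\Phi>0$ there is $\epsilon\ge0$ such that, for every sequence of vectors $c_k$ with $\|c_k\|\le\bar\Phi$, every trajectory with $\tilde\Phi_k=c_k$ for all $k$ satisfies $\limsup_{t\to\infty}\max_{i,j}\|\xi_i(t)-\xi_j(t)\|\le\epsilon$. 3. (State-dependent jumps.) Let $\hat\Xi_{\phi,\hat\phi}$ be real matrices, $U=\max(1,\max_{\phi,\hat\phi}\|\tilde\Xi_{\phi,\hat\phi}+\hat\Xi_{\phi,\hat\phi}\|^2)$, and suppose that the TDADT conditions hold. Then every trajectory with $\tilde\Phi_k=\hat\Xi_{\sigma_k,\sigma_{k-1}}\tilde\delta(t_k^-)$ for all $k$ achieves consensus: $\lim_{t\to\infty}\max_{i,j}\|\xi_i(t)-\xi_j(t)\|=0$. -/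

import Mathlib

open Set Filter Topology MeasureTheory
open scoped Kronecker Matrix

noncomputable section

/-- A Zeno-free, piecewise constant, right-continuous switching signal with values in the modes
`{0, …, s-1}`, with initial time `instant 0 = t₀ ≥ 0` and infinitely many switching instants
`instant 1 < instant 2 < ⋯` tending to infinity. -/
structure SwitchingSignal (s : ℕ) where
  /-- the signal `t ↦ σ(t)` -/
  sig : ℝ → Fin s
  /-- `instant 0` is the initial time, `instant k` (`k ≥ 1`) is the `k`-th switching instant -/
  instant : ℕ → ℝ
  instant_zero_nonneg : 0 ≤ instant 0
  instant_strictMono : StrictMono instant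
  instant_tendsto : Tendsto instant atTop atTop
  sig_const : ∀ k, ∀ t ∈ Ico (instant k) (instant (k + 1)), sig t = sig (instant k)

namespace SwitchingSignal

variable {s : ℕ} (σ : SwitchingSignal s)

/-- The mode on `[t_k, t_{k+1})`, i.e. `σ(t_k⁺) = σ(t_{k+1}⁻)`. -/
def mode (k : ℕ) : Fin s := σ.sig (σ.instant k)

/-- The `(k+1)`-st switching is a transition from `φ'` to `φ`. -/
def Transition (φ φ' : Fin s) (k : ℕ) : Prop := σ.mode (k + 1) = φ ∧ σ.mode k = φ'

/-- `N_{φ,φ'}(a,b)`: the number of switchings from `φ'` to `φ` on `[a,b)`. -/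
def numSwitch (φ φ' : Fin s) (a b : ℝ) : ℕ :=
  {k : ℕ | σ.instant (k + 1) ∈ Ico a b ∧ σ.Transition φ φ' k}.ncard

/-- `T_{φ,φ'}(a,b)`: the total time in `[a,b)` during which `φ` is active with precedent mode
`φ'`. -/
def activeTime (φ φ' : Fin s) (a b : ℝ) : ℝ :=
  volume.real {u : ℝ | u ∈ Ico a b ∧
    ∃ k, u ∈ Ico (σ.instant (k + 1)) (σ.instant (k + 2)) ∧ σ.Transition φ φ' k}

/-- `τ` is a transition-dependent average dwell time (TDADT), slow switching. -/
def IsSlowTDADT (φ φ' : Fin s) (τ : ℝ) : Prop :=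
  0 < τ ∧ ∃ N0 : ℝ, ∀ t, σ.instant 0 < t →
    (σ.numSwitch φ φ' (σ.instant 0) t : ℝ) ≤ N0 + σ.activeTime φ φ' (σ.instant 0) t / τ

/-- `τ` is a transition-dependent average dwell time (TDADT), fast switching. -/
def IsFastTDADT (φ φ' : Fin s) (τ : ℝ) : Prop :=
  0 < τ ∧ ∃ N0 : ℝ, ∀ t, σ.instant 0 < t →
    N0 + σ.activeTime φ φ' (σ.instant 0) t / τ ≤ (σ.numSwitch φ φ' (σ.instant 0) t : ℝ)

/-- The piecewise TDADT `τ_{φ,φ'}(a,b) = T_{φ,φ'}(a,b) / N_{φ,φ'}(a,b)`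
(meaningful when `N_{φ,φ'}(a,b) ≠ 0`). -/
def piecewiseTDADT (φ φ' : Fin s) (a b : ℝ) : ℝ :=
  σ.activeTime φ φ' a b / (σ.numSwitch φ φ' a b : ℝ)

/-- Quasi-alternative switching with respect to the set `Ps` of stable modes: an unstable mode is
always followed by a stable one. -/
def QuasiAlternative (Ps : Set (Fin s)) : Prop :=
  ∀ k, σ.mode k ∉ Ps → σ.mode (k + 1) ∈ Ps

/-- The TDADT conditions with rates `g φ` and jump gains `Ω φ φ'`, for every transition that
occurs. -/
def TDADTCondition (Ps : Set (Fin s)) (g : Fin s → ℝ) (Ω : Fin s → Fin s → ℝ)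
    (τ : Fin s → Fin s → ℝ) : Prop :=
  ∀ φ φ', (∃ k, σ.Transition φ φ' k) →
    (φ ∈ Ps → σ.IsSlowTDADT φ φ' (τ φ φ') ∧ -Real.log (Ω φ φ') / g φ ≤ τ φ φ') ∧
    (φ ∉ Ps → σ.IsFastTDADT φ φ' (τ φ φ') ∧ τ φ φ' ≤ -Real.log (Ω φ φ') / g φ)

/-- The piecewise TDADT conditions: for all `1 ≤ j ≤ k`, on `[t_j, t_{k+1})`. -/
def PiecewiseTDADTCondition (Ps : Set (Fin s)) (g : Fin s → ℝ) (Ω : Fin s → Fin s → ℝ) : Prop :=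
  ∀ φ φ', ∀ j k : ℕ, 1 ≤ j → j ≤ k →
    σ.numSwitch φ φ' (σ.instant j) (σ.instant (k + 1)) ≠ 0 →
    (φ ∈ Ps → -Real.log (Ω φ φ') / g φ ≤
      σ.piecewiseTDADT φ φ' (σ.instant j) (σ.instant (k + 1))) ∧
    (φ ∉ Ps → σ.piecewiseTDADT φ φ' (σ.instant j) (σ.instant (k + 1)) ≤
      -Real.log (Ω φ φ') / g φ)

end SwitchingSignal

/-- Matrix acting on Euclidean vectors. -/
def mulE {ι κ : Type*} [Fintype κ] (M : Matrix ι κ ℝ) (x : EuclideanSpace ℝ κ) :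
    EuclideanSpace ℝ ι := WithLp.toLp 2 (M *ᵥ x.ofLp)

/-- Induced 2-norm of a real matrix. -/
def norm2 {ι κ : Type*} [Fintype ι] [Fintype κ] [DecidableEq κ] (M : Matrix ι κ ℝ) : ℝ :=
  ‖(Matrix.toLpLin 2 2 M : EuclideanSpace ℝ κ →ₗ[ℝ] EuclideanSpace ℝ ι).toContinuousLinearMap‖

/-- Largest eigenvalue of a real symmetric matrix. -/
def lamMax {ι : Type*} [Fintype ι] [DecidableEq ι] (M : Matrix ι ι ℝ) : ℝ := sSup (spectrum ℝ M)

/-- Smallest eigenvalue of a real symmetric matrix. -/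
def lamMin {ι : Type*} [Fintype ι] [DecidableEq ι] (M : Matrix ι ι ℝ) : ℝ := sInf (spectrum ℝ M)

/-- `x` is a trajectory of the linear multi-dimensional switched system (MDSS) with mode matrices
`A φ`, 0-1 dimension-variation matrices `Xi φ φ'` and jump vectors `Φ k`. Here `x k` is the state
on `[t_k, t_{k+1})` and `x k t_{k+1}` is its left limit at `t_{k+1}`. -/
def IsLinearMDSSTrajectory {s : ℕ} (σ : SwitchingSignal s) (ι : Fin s → Type)
    [∀ φ, Fintype (ι φ)] (A : ∀ φ, Matrix (ι φ) (ι φ) ℝ) (Xi : ∀ φ φ', Matrix (ι φ) (ι φ') ℝ)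
    (Φ : ∀ k, EuclideanSpace ℝ (ι (σ.mode (k + 1))))
    (x : ∀ k, ℝ → EuclideanSpace ℝ (ι (σ.mode k))) : Prop :=
  (∀ φ φ' i j, Xi φ φ' i j = 0 ∨ Xi φ φ' i j = 1) ∧
  (∀ k, ∀ t ∈ Icc (σ.instant k) (σ.instant (k + 1)),
    HasDerivWithinAt (x k) (mulE (A (σ.mode k)) (x k t))
      (Icc (σ.instant k) (σ.instant (k + 1))) t) ∧
  (∀ k, x (k + 1) (σ.instant (k + 1)) =
    mulE (Xi (σ.mode (k + 1)) (σ.mode k)) (x k (σ.instant (k + 1))) + Φ k)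

/-- Open multi-agent system with `s` modes and agents with state in `ℝ^p`.
Mode `φ` has `n φ + 1 ≥ 2` agents; `(graph φ).Adj j i` is the directed edge from `j` to `i`. -/
structure OpenMAS (s p : ℕ) where
  /-- number of agents of the mode, minus one -/
  n : Fin s → ℕ
  n_pos : ∀ φ, 0 < n φ
  p_pos : 0 < p
  graph : ∀ φ, Digraph (Fin (n φ + 1))
  loopless : ∀ φ i, ¬ (graph φ).Adj i i
  /-- agent dynamics -/
  S : Matrix (Fin p) (Fin p) ℝ
  S_re_pos : ∀ z ∈ spectrum ℂ (S.map (algebraMap ℝ ℂ)), 0 < z.re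
  /-- coupling gain -/
  rho : ℝ
  rho_pos : 0 < rho
  /-- `origin φ φ' i = some j`: at a transition from `φ'` to `φ`, the agent with label `i` after
  the transition carries on the state of the agent with label `j` before it; `none`: a newly
  inserted agent. An old label not in the range is that of a removed agent. -/
  origin : ∀ φ φ', Fin (n φ + 1) → Option (Fin (n φ' + 1))
  /-- Rows of the identity are only removed, and zero rows inserted: the order is kept. -/
  origin_mono : ∀ φ φ' i i' j j', i < i' → origin φ φ' i = some j → origin φ φ' i' = some j' →
    j < j'

namespace OpenMAS

variable {s p : ℕ} (M : OpenMAS s p)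

/-- Index type of the stacked state of all agents in mode `φ`. -/
abbrev Full (φ : Fin s) : Type := Fin (M.n φ + 1) × Fin p

/-- Index type of the stacked disagreement state in mode `φ`. -/
abbrev Red (φ : Fin s) : Type := Fin (M.n φ) × Fin p

open Classical in
/-- Adjacency matrix: `a_ij = 1` iff there is an edge from `j` to `i`. -/
def adj (φ : Fin s) : Matrix (Fin (M.n φ + 1)) (Fin (M.n φ + 1)) ℝ :=
  Matrix.of fun i j => if (M.graph φ).Adj j i then 1 else 0

/-- Laplacian matrix. -/
def lap (φ : Fin s) : Matrix (Fin (M.n φ + 1)) (Fin (M.n φ + 1)) ℝ :=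
  Matrix.diagonal (fun i => ∑ j, M.adj φ i j) - M.adj φ

/-- Reduced Laplacian `z_ij = l_ij - l_Nj`, `1 ≤ i, j ≤ N - 1`. -/
def Z (φ : Fin s) : Matrix (Fin (M.n φ)) (Fin (M.n φ)) ℝ :=
  Matrix.of fun i j =>
    M.lap φ i.castSucc j.castSucc - M.lap φ (Fin.last (M.n φ)) j.castSucc

/-- Matrix of the disagreement dynamics, `I ⊗ S - ϱ Z ⊗ I`. -/
def A (φ : Fin s) : Matrix (M.Red φ) (M.Red φ) ℝ :=
  (1 : Matrix (Fin (M.n φ)) (Fin (M.n φ)) ℝ) ⊗ₖ M.S -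
    M.rho • (M.Z φ ⊗ₖ (1 : Matrix (Fin p) (Fin p) ℝ))

/-- The modes whose digraph contains a directed spanning tree (some root reaches every vertex). -/
def Ps : Set (Fin s) :=
  {φ | ∃ r, ∀ v, Relation.ReflTransGen (M.graph φ).Adj r v}

/-- State of one agent. -/
def agent {φ : Fin s} (x : EuclideanSpace ℝ (M.Full φ)) (i : Fin (M.n φ + 1)) :
    EuclideanSpace ℝ (Fin p) := WithLp.toLp 2 fun a => x (i, a)

/-- 0-1 matrix of the dimension variation at a transition from `φ'` to `φ`. -/
def Xi (φ φ' : Fin s) : Matrix (M.Full φ) (M.Full φ') ℝ :=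
  Matrix.of fun i j => if M.origin φ φ' i.1 = some j.1 ∧ i.2 = j.2 then 1 else 0

/-- `Xi` without its last `p` rows and columns. -/
def XiRed (φ φ' : Fin s) : Matrix (M.Red φ) (M.Red φ') ℝ :=
  Matrix.of fun i j => M.Xi φ φ' (i.1.castSucc, i.2) (j.1.castSucc, j.2)

/-- Stacked differences `ξ_i - ξ_N`, `i = 1, …, N - 1`. -/
def dis {φ : Fin s} (x : EuclideanSpace ℝ (M.Full φ)) : EuclideanSpace ℝ (M.Red φ) :=
  WithLp.toLp 2 fun i => x (i.1.castSucc, i.2) - x (Fin.last (M.n φ), i.2)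

variable (σ : SwitchingSignal s)

/-- A trajectory of the open MAS with jump vectors `Φ k` at `t_{k+1}`. Here `ξ k` is the stacked
state on `[t_k, t_{k+1})` and `ξ k t_{k+1}` its left limit at `t_{k+1}`. -/
def IsTrajectory (Φ : ∀ k, EuclideanSpace ℝ (M.Full (σ.mode (k + 1))))
    (ξ : ∀ k, ℝ → EuclideanSpace ℝ (M.Full (σ.mode k))) : Prop :=
  (∀ k, ∀ t ∈ Icc (σ.instant k) (σ.instant (k + 1)), ∀ i,
    HasDerivWithinAt (fun u => M.agent (ξ k u) i)
      (mulE M.S (M.agent (ξ k t) i) -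
        M.rho • ∑ j, M.adj (σ.mode k) i j • (M.agent (ξ k t) i - M.agent (ξ k t) j))
      (Icc (σ.instant k) (σ.instant (k + 1))) t) ∧
  (∀ k, ξ (k + 1) (σ.instant (k + 1)) =
    mulE (M.Xi (σ.mode (k + 1)) (σ.mode k)) (ξ k (σ.instant (k + 1))) + Φ k)

/-- The transformed jump of the disagreement state for a transition from `φ'` to `φ`, pre-switching
state `x` and jump `v`: the differences of `v`, plus the part due to the reference agent and to the
dimension variation. -/
def jumpRed {φ φ' : Fin s} (x : EuclideanSpace ℝ (M.Full φ')) (v : EuclideanSpace ℝ (M.Full φ)) :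
    EuclideanSpace ℝ (M.Red φ) :=
  M.dis v + (M.dis (mulE (M.Xi φ φ') x) - mulE (M.XiRed φ φ') (M.dis x))

/-- `lim sup` as `t → ∞` of all disagreements `‖ξ_i(t) - ξ_j(t)‖` is at most `ε`. -/
def UltimateDisagreementLE (ξ : ∀ k, ℝ → EuclideanSpace ℝ (M.Full (σ.mode k))) (ε : ℝ) : Prop :=
  ∀ ε' > ε, ∀ᶠ t in atTop, ∀ k, t ∈ Ico (σ.instant k) (σ.instant (k + 1)) →
    ∀ i j, ‖M.agent (ξ k t) i - M.agent (ξ k t) j‖ ≤ ε'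

/-- `max (1, max_{φ,φ'} ‖Q φ φ'‖²)`. -/
def upsilon (Q : ∀ φ φ', Matrix (M.Red φ) (M.Red φ') ℝ) : ℝ :=
  max 1 (⨆ φ, ⨆ φ', norm2 (Q φ φ') ^ 2)

variable (P : ∀ φ, Matrix (M.Red φ) (M.Red φ) ℝ)

open Classical in
/-- The rate `γ̃_φ`. -/
def rate (γ : Fin s → ℝ) (φ : Fin s) : ℝ :=
  if φ ∈ M.Ps then -1 / lamMax (P φ) + 2 * γ φ else 2 * γ φ

/-- The jump gain that a transition from `φ'` to `φ` has when `η` is left unchanged. -/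
def gain (U : ℝ) (φ φ' : Fin s) : ℝ := 2 * lamMax (P φ) / lamMin (P φ') * U

open Classical in
/-- The update procedure for the parameter `η_k` of the Lyapunov functions: when an unstable mode
is entered and the gain is at least one, `η` is decreased so that the gain becomes `χ`; at the
next instant, when a stable mode is entered, that decrease is undone; otherwise `η` is kept. -/
def eta (U η₀ : ℝ) (χ : Fin s → Fin s → ℝ) : ℕ → ℝ
  | 0 => η₀
  | k + 1 =>
    if σ.mode (k + 1) ∉ M.Ps ∧ 1 ≤ M.gain P U (σ.mode (k + 1)) (σ.mode k) then
      χ (σ.mode (k + 1)) (σ.mode k) * eta U η₀ χ k / M.gain P U (σ.mode (k + 1)) (σ.mode k)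
    else if σ.mode (k + 1) ∈ M.Ps ∧ σ.mode k ∉ M.Ps ∧ 1 ≤ k ∧
        1 ≤ M.gain P U (σ.mode k) (σ.mode (k - 1)) then
      M.gain P U (σ.mode k) (σ.mode (k - 1)) * eta U η₀ χ k / χ (σ.mode k) (σ.mode (k - 1))
    else eta U η₀ χ k

/-- `Ω_{φ,φ'}`: the maximum of `2 η_{k+1} λ_max(P_φ) / (η_k λ_min(P_φ')) · U` over the
transitions from `φ'` to `φ`. -/
def Omega (U η₀ : ℝ) (χ : Fin s → Fin s → ℝ) (φ φ' : Fin s) : ℝ :=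
  sSup {w : ℝ | ∃ k, σ.Transition φ φ' k ∧
    w = 2 * (M.eta σ P U η₀ χ (k + 1) * lamMax (P φ)) /
      (M.eta σ P U η₀ χ k * lamMin (P φ')) * U}

end OpenMAS

end

/-! The function V = η_k δᵀPδ is followed along the disagreement δ, which obeys a linear switched
system because Laplacian rows sum to zero. Between switchings, the Lyapunov equation bounds the
growth of V by the rate of the active mode (`quadForm_flow_le`, `lyapunov_rate`). Across a switching
with jump linear in δ, the extreme eigenvalues of P give V⁺ ≤ ½ Ω V (`eta_mul_lamMax_mul_le`). The ½
is the slack left by the factor 2 in Ω. All decay comes from it; the dwell-time conditions only have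
to keep the factors Ω·exp(rate·length) under control.

An unstable mode is tolerable only if it is entered with Ω < 1, which the scaling η arranges
(`log_Omega_neg`). Since a stable mode always follows, each decrease of η is undone at once, so η
takes finitely many values (`eta_succ_eq`). Hence V stays comparable to ‖δ‖² and the suprema
defining Ω are finite.

For linear jumps, the TDADT conditions bound every partial sum of log Ω + rate·length by a constant
C, so V at the end of the k-th interval is at most 2⁻ᵏ exp(C) V₀. For bounded jumps, Young's
inequality with weights 3/2 and 3 turns ½ into ¾ and leaves an additive constant. The piecewise
condition on one interval gives Ω·exp(rate·length) ≤ 1, so V satisfies a ¾-contraction with a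
bounded forcing term, whose limiting bound does not depend on the trajectory. -/

/-! ### Quadratic forms and extreme eigenvalues -/

section QuadraticForm

variable {ι κ : Type*} [Fintype ι]

/-- The quadratic form `xᵀ P x`. -/
noncomputable def quadForm (P : Matrix ι ι ℝ) (x : EuclideanSpace ℝ ι) : ℝ := inner ℝ x (mulE P x)

theorem inner_eq_dotProduct_ofLp (x y : EuclideanSpace ℝ ι) :
    inner ℝ x y = x.ofLp ⬝ᵥ y.ofLp := by
  rw [EuclideanSpace.inner_eq_star_dotProduct, dotProduct_comm]
  simp

theorem inner_mulE_left [Fintype κ] (M : Matrix κ ι ℝ) (x : EuclideanSpace ℝ ι) (y : EuclideanSpace ℝ κ) :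
    inner ℝ (mulE M x) y = inner ℝ x (mulE Mᵀ y) := by
  simp only [inner_eq_dotProduct_ofLp, mulE]
  rw [Matrix.dotProduct_mulVec, Matrix.vecMul_transpose]

theorem mulE_mulE [Fintype κ] {μ : Type*} (M : Matrix μ κ ℝ) (N : Matrix κ ι ℝ)
    (x : EuclideanSpace ℝ ι) : mulE M (mulE N x) = mulE (M * N) x := by
  simp [mulE, Matrix.mulVec_mulVec]

theorem add_mulE (M N : Matrix κ ι ℝ) (x : EuclideanSpace ℝ ι) :
    mulE (M + N) x = mulE M x + mulE N x := by
  simp [mulE, Matrix.add_mulVec]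

theorem sub_mulE (M N : Matrix κ ι ℝ) (x : EuclideanSpace ℝ ι) :
    mulE (M - N) x = mulE M x - mulE N x := by
  simp [mulE, Matrix.sub_mulVec]

theorem smul_mulE (c : ℝ) (M : Matrix κ ι ℝ) (x : EuclideanSpace ℝ ι) :
    mulE (c • M) x = c • mulE M x := by
  simp [mulE, Matrix.smul_mulVec]

theorem neg_mulE (M : Matrix κ ι ℝ) (x : EuclideanSpace ℝ ι) : mulE (-M) x = -mulE M x := by
  simp [mulE, Matrix.neg_mulVec]

variable [DecidableEq ι]

theorem one_mulE (x : EuclideanSpace ℝ ι) : mulE (1 : Matrix ι ι ℝ) x = x := by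
  simp [mulE]

section Norm

variable [Fintype κ]

theorem norm_mulE_le (M : Matrix κ ι ℝ) (x : EuclideanSpace ℝ ι) :
    ‖mulE M x‖ ≤ norm2 M * ‖x‖ :=
  (Matrix.toLpLin 2 2 M : EuclideanSpace ℝ ι →ₗ[ℝ] EuclideanSpace ℝ κ).toContinuousLinearMap.le_opNorm x

theorem HasDerivWithinAt.mulE {x : ℝ → EuclideanSpace ℝ ι} {x' : EuclideanSpace ℝ ι} {s : Set ℝ}
    {t : ℝ} (M : Matrix κ ι ℝ) (hx : HasDerivWithinAt x x' s t) :
    HasDerivWithinAt (fun u => _root_.mulE M (x u)) (_root_.mulE M x') s t :=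
  ((Matrix.toLpLin 2 2 M : EuclideanSpace ℝ ι →ₗ[ℝ] EuclideanSpace ℝ κ).toContinuousLinearMap.hasFDerivAt.comp_hasDerivWithinAt
    t hx)

end Norm

theorem le_lamMax {P : Matrix ι ι ℝ} {r : ℝ} (hr : r ∈ spectrum ℝ P) : r ≤ lamMax P :=
  le_csSup P.finite_real_spectrum.bddAbove hr

theorem lamMin_le {P : Matrix ι ι ℝ} {r : ℝ} (hr : r ∈ spectrum ℝ P) : lamMin P ≤ r :=
  csInf_le P.finite_real_spectrum.bddBelow hr

/-- The spectrum of λ_max·1 - P is the reflected and shifted spectrum of P, hence nonnegative, so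
this matrix is positive semidefinite. -/
theorem quadForm_le_lamMax {P : Matrix ι ι ℝ} (hP : P.IsHermitian) (x : EuclideanSpace ℝ ι) :
    quadForm P x ≤ lamMax P * ‖x‖ ^ 2 := by
  have hH : (algebraMap ℝ (Matrix ι ι ℝ) (lamMax P) - P).IsHermitian := by
    refine Matrix.IsHermitian.sub ?_ hP
    rw [Algebra.algebraMap_eq_smul_one]
    simp [Matrix.IsHermitian]
  have hpos : (algebraMap ℝ (Matrix ι ι ℝ) (lamMax P) - P).PosSemidef := by
    rw [hH.posSemidef_iff_eigenvalues_nonneg]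
    intro i
    have := hH.eigenvalues_mem_spectrum_real i
    rw [← spectrum.singleton_sub_eq] at this
    obtain ⟨a, rfl, b, hb, hab⟩ := this
    have := le_lamMax hb
    simp only at hab
    simp only [Pi.zero_apply]
    linarith
  have h := hpos.dotProduct_mulVec_nonneg x.ofLp
  rw [Algebra.algebraMap_eq_smul_one] at h
  have : inner ℝ x (mulE (lamMax P • (1 : Matrix ι ι ℝ) - P) x) =
      lamMax P * ‖x‖ ^ 2 - quadForm P x := by
    rw [sub_mulE, smul_mulE, one_mulE, inner_sub_right, real_inner_smul_right,
      real_inner_self_eq_norm_sq, quadForm]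
  rw [inner_eq_dotProduct_ofLp] at this
  simp only [star_trivial] at h
  simp only [mulE] at this
  linarith

theorem lamMin_le_quadForm {P : Matrix ι ι ℝ} (hP : P.IsHermitian) (x : EuclideanSpace ℝ ι) :
    lamMin P * ‖x‖ ^ 2 ≤ quadForm P x := by
  have h := quadForm_le_lamMax hP.neg x
  have h1 : quadForm (-P) x = -quadForm P x := by
    simp [quadForm, neg_mulE]
  have h2 : lamMax (-P) = -lamMin P := by
    rw [lamMax, lamMin, ← spectrum.neg_eq, Real.sInf_def, neg_neg]
  rw [h1, h2] at h
  linarith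

theorem Matrix.PosDef.lamMin_pos [Nonempty ι] {P : Matrix ι ι ℝ} (hP : P.PosDef) :
    0 < lamMin P := by
  have hne : (spectrum ℝ P).Nonempty :=
    ⟨_, hP.isHermitian.eigenvalues_mem_spectrum_real (Classical.arbitrary ι)⟩
  have h := hne.csInf_mem P.finite_real_spectrum
  rw [hP.isHermitian.spectrum_real_eq_range_eigenvalues] at h
  obtain ⟨i, hi⟩ := h
  rw [lamMin, hP.isHermitian.spectrum_real_eq_range_eigenvalues, ← hi]
  exact hP.eigenvalues_pos i

theorem Matrix.PosDef.lamMax_pos [Nonempty ι] {P : Matrix ι ι ℝ} (hP : P.PosDef) :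
    0 < lamMax P := by
  have h := hP.isHermitian.eigenvalues_mem_spectrum_real (Classical.arbitrary ι)
  exact hP.lamMin_pos.trans_le ((lamMin_le h).trans (le_lamMax h))

/-- Growth of a Lyapunov function with rate `g` along a linear flow. -/
theorem quadForm_flow_le {A P : Matrix ι ι ℝ} {γ g : ℝ}
    (hL : Aᵀ * P + P * A - (2 * γ) • P = -1)
    (hg : ∀ x, 2 * γ * quadForm P x - ‖x‖ ^ 2 ≤ g * quadForm P x)
    {x : ℝ → EuclideanSpace ℝ ι} {a b : ℝ}
    (hx : ∀ t ∈ Icc a b, HasDerivWithinAt x (mulE A (x t)) (Icc a b) t) {t : ℝ}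
    (ht : t ∈ Icc a b) :
    quadForm P (x t) ≤ Real.exp (g * (t - a)) * quadForm P (x a) := by
  -- The derivative is xᵀ(AᵀP + PA)x, and the Lyapunov equation replaces the matrix by 2γP - 1.
  have hd : ∀ u ∈ Icc a b, HasDerivWithinAt (fun u => quadForm P (x u))
      (2 * γ * quadForm P (x u) - ‖x u‖ ^ 2) (Icc a b) u := by
    intro u hu
    have h := (hx u hu).inner ℝ ((hx u hu).mulE P)
    convert! h using 1
    rw [inner_mulE_left, mulE_mulE, mulE_mulE, ← inner_add_right, add_comm, ← add_mulE]
    rw [sub_eq_iff_eq_add] at hL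
    rw [hL, add_mulE, smul_mulE, neg_mulE, one_mulE, inner_add_right, inner_neg_right,
      real_inner_smul_right, real_inner_self_eq_norm_sq, quadForm]
    ring
  have hd2 : ∀ u ∈ Icc a b, HasDerivWithinAt
      (fun u => Real.exp (-(g * (u - a))) * quadForm P (x u))
      (Real.exp (-(g * (u - a))) * (-g) * quadForm P (x u) +
        Real.exp (-(g * (u - a))) * (2 * γ * quadForm P (x u) - ‖x u‖ ^ 2)) (Icc a b) u := by
    intro u hu
    have h1 : HasDerivWithinAt (fun u : ℝ => -(g * (u - a))) (-g) (Icc a b) u := by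
      have := (((hasDerivAt_id u).sub_const a).const_mul g).neg
      rw [mul_one] at this
      exact this.hasDerivWithinAt
    exact h1.exp.mul (hd u hu)
  -- Grönwall by integrating factor: `hg` says exactly that this product has nonpositive derivative.
  have hanti : AntitoneOn (fun u => Real.exp (-(g * (u - a))) * quadForm P (x u)) (Icc a b) := by
    refine antitoneOn_of_hasDerivWithinAt_nonpos (convex_Icc a b)
      (fun u hu => (hd2 u hu).continuousWithinAt)
      (fun u hu => (hd2 u (interior_subset hu)).mono interior_subset) ?_
    intro u _
    have h1 := hg (x u)
    have h2 := Real.exp_pos (-(g * (u - a)))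
    nlinarith [mul_le_mul_of_nonneg_left h1 h2.le]
  have h := hanti (left_mem_Icc.2 (ht.1.trans ht.2)) ht ht.1
  simp only [sub_self, mul_zero, neg_zero, Real.exp_zero, one_mul] at h
  calc quadForm P (x t)
      = Real.exp (g * (t - a)) * (Real.exp (-(g * (t - a))) * quadForm P (x t)) := by
        rw [← mul_assoc, ← Real.exp_add]; simp
    _ ≤ _ := mul_le_mul_of_nonneg_left h (Real.exp_pos _).le

end QuadraticForm

/-! ### Counting switchings -/

namespace SwitchingSignal

variable {s : ℕ} (σ : SwitchingSignal s)

open Classical in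
/-- The transitions from `φ'` to `φ` at the instants `j, …, m - 1`, shifted by one. -/
noncomputable def transitions (φ φ' : Fin s) (j m : ℕ) : Finset ℕ :=
  (Finset.range m).filter fun k => (j ≤ k + 1 ∧ k + 1 < m) ∧ σ.Transition φ φ' k

theorem mem_transitions {φ φ' : Fin s} {j m k : ℕ} :
    k ∈ σ.transitions φ φ' j m ↔ (j ≤ k + 1 ∧ k + 1 < m) ∧ σ.Transition φ φ' k := by
  simp only [transitions, Finset.mem_filter, Finset.mem_range]
  constructor
  · exact fun h => h.2
  · exact fun h => ⟨by omega, h⟩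

theorem numSwitch_instant (φ φ' : Fin s) (j m : ℕ) :
    σ.numSwitch φ φ' (σ.instant j) (σ.instant m) = (σ.transitions φ φ' j m).card := by
  rw [numSwitch, ← Set.ncard_coe_finset]
  congr 1
  ext k
  simp only [Set.mem_ofPred_eq, Finset.mem_coe, mem_transitions, mem_Ico,
    σ.instant_strictMono.le_iff_le, σ.instant_strictMono.lt_iff_lt]

theorem pairwise_disjoint_Ico_instant :
    Pairwise (Function.onFun Disjoint fun k => Ico (σ.instant (k + 1)) (σ.instant (k + 2))) := by
  have h : Monotone fun k => σ.instant (k + 1) :=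
    fun a b hab => σ.instant_strictMono.monotone (Nat.succ_le_succ hab)
  exact h.pairwise_disjoint_on_Ico_succ

/-- As both ends of the window are switching instants, every mode interval lies inside it or misses
it, so no interval is cut. -/
theorem activeTime_instant (φ φ' : Fin s) (j m : ℕ) :
    σ.activeTime φ φ' (σ.instant j) (σ.instant m) =
      ∑ k ∈ σ.transitions φ φ' j m, (σ.instant (k + 2) - σ.instant (k + 1)) := by
  have hset : {u : ℝ | u ∈ Ico (σ.instant j) (σ.instant m) ∧
      ∃ k, u ∈ Ico (σ.instant (k + 1)) (σ.instant (k + 2)) ∧ σ.Transition φ φ' k} =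
      ⋃ k ∈ σ.transitions φ φ' j m, Ico (σ.instant (k + 1)) (σ.instant (k + 2)) := by
    ext u
    simp only [Set.mem_ofPred_eq, mem_iUnion, mem_transitions, mem_Ico, exists_prop]
    constructor
    · rintro ⟨⟨h1, h2⟩, k, ⟨h3, h4⟩, h5⟩
      have h6 := σ.instant_strictMono.lt_iff_lt.1 (h3.trans_lt h2)
      have h7 := σ.instant_strictMono.lt_iff_lt.1 (h1.trans_lt h4)
      exact ⟨k, ⟨⟨by omega, h6⟩, h5⟩, h3, h4⟩
    · rintro ⟨k, ⟨⟨h1, h2⟩, h5⟩, h3, h4⟩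
      have hm := σ.instant_strictMono.monotone
      exact ⟨⟨(hm h1).trans h3, h4.trans_le (hm h2)⟩, k, ⟨h3, h4⟩, h5⟩
  rw [activeTime, hset, measureReal_biUnion_finset
    (fun a _ b _ hab => σ.pairwise_disjoint_Ico_instant hab) (fun _ _ => measurableSet_Ico)
    (fun _ _ => measure_Ico_lt_top.ne)]
  refine Finset.sum_congr rfl fun k _ => ?_
  rw [Real.volume_real_Ico_of_le (σ.instant_strictMono.monotone (by omega))]

theorem transitions_succ (k : ℕ) :
    σ.transitions (σ.mode (k + 1)) (σ.mode k) (k + 1) (k + 2) = {k} := by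
  ext i
  rw [mem_transitions, Finset.mem_singleton]
  constructor
  · rintro ⟨h, _⟩; omega
  · rintro rfl; exact ⟨⟨le_rfl, by omega⟩, rfl, rfl⟩

theorem length_pos (k : ℕ) : 0 < σ.instant (k + 1) - σ.instant k :=
  sub_pos.2 (σ.instant_strictMono (Nat.lt_succ_self k))

open Classical in
-- Regroups the switchings by transition pair, the form in which the dwell-time hypotheses speak.
-- The bound is K + 1 because transition k happens at instant k + 1.
theorem sum_range_eq_sum_transitions (f : ℕ → ℝ) (K : ℕ) :
    ∑ k ∈ Finset.range K, f k =
      ∑ q : Fin s × Fin s, ∑ k ∈ σ.transitions q.1 q.2 0 (K + 1), f k := by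
  rw [← Finset.sum_fiberwise (Finset.range K) (fun k => (σ.mode (k + 1), σ.mode k)) f]
  refine Finset.sum_congr rfl fun q _ => Finset.sum_congr ?_ fun _ _ => rfl
  ext k
  simp only [Finset.mem_filter, Finset.mem_range, mem_transitions, Transition, Prod.ext_iff]
  constructor
  · rintro ⟨h, h1, h2⟩; exact ⟨⟨by omega, by omega⟩, h1, h2⟩
  · rintro ⟨⟨_, h⟩, h1, h2⟩; exact ⟨by omega, h1, h2⟩

end SwitchingSignal

/-! ### Consequences of the dwell-time conditions. -/

namespace SwitchingSignal

variable {s : ℕ} (σ : SwitchingSignal s)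

theorem activeTime_nonneg (φ φ' : Fin s) (a b : ℝ) : 0 ≤ σ.activeTime φ φ' a b :=
  measureReal_nonneg

variable {σ}

theorem IsSlowTDADT.exists_le {φ φ' : Fin s} {τ g ω : ℝ} (h : σ.IsSlowTDADT φ φ' τ) (hg : g < 0)
    (hτ : -ω / g ≤ τ) :
    ∃ C, ∀ t, σ.instant 0 < t →
      σ.numSwitch φ φ' (σ.instant 0) t * ω + g * σ.activeTime φ φ' (σ.instant 0) t ≤ C := by
  obtain ⟨hτ0, N0, hN⟩ := h
  -- The absolute value serves both signs of ω: if ω ≤ 0 the left side is already nonpositive,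
  -- otherwise N0 * ω is the bound.
  refine ⟨|N0 * ω|, fun t ht => ?_⟩
  have h1 := hN t ht
  have hT := σ.activeTime_nonneg φ φ' (σ.instant 0) t
  have hn : (0 : ℝ) ≤ σ.numSwitch φ φ' (σ.instant 0) t := Nat.cast_nonneg _
  set T := σ.activeTime φ φ' (σ.instant 0) t
  set n : ℝ := (σ.numSwitch φ φ' (σ.instant 0) t : ℝ)
  rw [div_le_iff_of_neg hg] at hτ
  rcases le_total ω 0 with hω | hω
  · have := mul_nonpos_of_nonneg_of_nonpos hn hω
    have := mul_nonpos_of_nonpos_of_nonneg hg.le hT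
    have := abs_nonneg (N0 * ω)
    linarith
  · have h2 := mul_le_mul_of_nonneg_right h1 hω
    have h3 : T / τ * ω ≤ T / τ * (-(τ * g)) :=
      mul_le_mul_of_nonneg_left (by linarith) (div_nonneg hT hτ0.le)
    have h4 : T / τ * (-(τ * g)) = -(g * T) := by field_simp
    have := le_abs_self (N0 * ω)
    linarith

/-- The dwell-time bound itself forces the sign: a positive τ below -ω / g with -ω > 0 leaves only g
> 0. -/
theorem IsFastTDADT.rate_pos {φ φ' : Fin s} {τ g ω : ℝ} (h : σ.IsFastTDADT φ φ' τ) (hω : ω < 0)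
    (hτ : τ ≤ -ω / g) : 0 < g :=
  (div_pos_iff_of_pos_left (neg_pos.2 hω)).1 (h.1.trans_le hτ)

theorem IsFastTDADT.exists_le {φ φ' : Fin s} {τ g ω : ℝ} (h : σ.IsFastTDADT φ φ' τ) (hω : ω < 0)
    (hτ : τ ≤ -ω / g) :
    ∃ C, ∀ t, σ.instant 0 < t →
      σ.numSwitch φ φ' (σ.instant 0) t * ω + g * σ.activeTime φ φ' (σ.instant 0) t ≤ C := by
  have hg := h.rate_pos hω hτ
  obtain ⟨hτ0, N0, hN⟩ := h
  refine ⟨N0 * ω, fun t ht => ?_⟩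
  have h1 := hN t ht
  have hT := σ.activeTime_nonneg φ φ' (σ.instant 0) t
  set T := σ.activeTime φ φ' (σ.instant 0) t
  set n : ℝ := (σ.numSwitch φ φ' (σ.instant 0) t : ℝ)
  rw [le_div_iff₀ hg] at hτ
  -- Multiplying by ω ≤ 0 turns the lower bound on the number of switchings into the upper bound
  -- needed.
  have h2 := mul_le_mul_of_nonpos_right h1 hω.le
  have h3 : T / τ * ω ≤ T / τ * (-(τ * g)) :=
    mul_le_mul_of_nonneg_left (by linarith) (div_nonneg hT hτ0.le)
  have h4 : T / τ * (-(τ * g)) = -(g * T) := by field_simp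
  linarith

/-- Under the TDADT conditions the accumulated growth exponents of all jumps and flows stay
bounded. -/
theorem TDADTCondition.exists_sum_le {Ps : Set (Fin s)} {g : Fin s → ℝ}
    {Ω τ : Fin s → Fin s → ℝ} (h : σ.TDADTCondition Ps g Ω τ) (hg : ∀ φ ∈ Ps, g φ < 0)
    (hΩ : ∀ φ φ', (∃ k, σ.Transition φ φ' k) → φ ∉ Ps → Real.log (Ω φ φ') < 0) :
    ∃ C, ∀ K, ∑ k ∈ Finset.range K, (Real.log (Ω (σ.mode (k + 1)) (σ.mode k)) +
      g (σ.mode (k + 1)) * (σ.instant (k + 2) - σ.instant (k + 1))) ≤ C := by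
  have hpair : ∀ q : Fin s × Fin s, ∃ C, ∀ K, ∑ k ∈ σ.transitions q.1 q.2 0 (K + 1),
      (Real.log (Ω (σ.mode (k + 1)) (σ.mode k)) +
        g (σ.mode (k + 1)) * (σ.instant (k + 2) - σ.instant (k + 1))) ≤ C := by
    rintro ⟨φ, φ'⟩
    by_cases hT : ∃ k, σ.Transition φ φ' k
    · have hC : ∃ C, ∀ t, σ.instant 0 < t → σ.numSwitch φ φ' (σ.instant 0) t * Real.log (Ω φ φ') +
          g φ * σ.activeTime φ φ' (σ.instant 0) t ≤ C := by
        by_cases hφ : φ ∈ Ps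
        · obtain ⟨h1, h2⟩ := (h φ φ' hT).1 hφ
          exact h1.exists_le (hg φ hφ) h2
        · obtain ⟨h1, h2⟩ := (h φ φ' hT).2 hφ
          exact h1.exists_le (hΩ φ φ' hT hφ) h2
      obtain ⟨C, hC⟩ := hC
      refine ⟨C, fun K => ?_⟩
      -- Ending the window at a switching instant pairs each counted jump with its whole following
      -- interval.
      have h1 := hC (σ.instant (K + 1)) (σ.instant_strictMono (Nat.succ_pos K))
      rw [numSwitch_instant, activeTime_instant, Finset.mul_sum, ← nsmul_eq_mul,
        ← Finset.sum_const, ← Finset.sum_add_distrib] at h1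
      refine le_trans (le_of_eq (Finset.sum_congr rfl fun k hk => ?_)) h1
      obtain ⟨_, h2, h3⟩ := (σ.mem_transitions).1 hk
      rw [h2, h3]
    · refine ⟨0, fun K => le_of_eq (Finset.sum_eq_zero fun k hk => ?_)⟩
      exact absurd ⟨k, ((σ.mem_transitions).1 hk).2⟩ hT
  choose C hC using hpair
  refine ⟨∑ q, C q, fun K => ?_⟩
  rw [sum_range_eq_sum_transitions]
  exact Finset.sum_le_sum fun q _ => hC q K

/-- Under the piecewise TDADT conditions, every jump followed by a flow over a complete interval
is non-expansive. -/
theorem PiecewiseTDADTCondition.log_add_le {Ps : Set (Fin s)} {g : Fin s → ℝ}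
    {Ω : Fin s → Fin s → ℝ} (h : σ.PiecewiseTDADTCondition Ps g Ω) (hg : ∀ φ ∈ Ps, g φ < 0)
    (hΩ : ∀ φ φ', (∃ k, σ.Transition φ φ' k) → φ ∉ Ps → Real.log (Ω φ φ') < 0) (k : ℕ) :
    Real.log (Ω (σ.mode (k + 1)) (σ.mode k)) +
      g (σ.mode (k + 1)) * (σ.instant (k + 2) - σ.instant (k + 1)) ≤ 0 := by
  -- A one-interval window contains exactly one switching, so the quotient is the length of that
  -- interval.
  have h1 := h (σ.mode (k + 1)) (σ.mode k) (k + 1) (k + 1) (by omega) le_rfl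
  rw [piecewiseTDADT, numSwitch_instant, activeTime_instant, transitions_succ] at h1
  simp only [Finset.card_singleton, Finset.sum_singleton, Nat.cast_one, div_one] at h1
  obtain ⟨hs, hu⟩ := h1 one_ne_zero
  have hL := σ.length_pos (k + 1)
  by_cases hφ : σ.mode (k + 1) ∈ Ps
  · have h2 := hs hφ
    rw [div_le_iff_of_neg (hg _ hφ)] at h2
    linarith
  · have h2 := hu hφ
    have hg0 := (div_pos_iff_of_pos_left (neg_pos.2 (hΩ _ _ ⟨k, rfl, rfl⟩ hφ))).1 (hL.trans_le h2)
    rw [le_div_iff₀ hg0] at h2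
    linarith

end SwitchingSignal

/-! ### Lyapunov rates and the scaling parameter η. -/

namespace OpenMAS

variable {s p : ℕ} {M : OpenMAS s p} {σ : SwitchingSignal s}
  {P : ∀ φ, Matrix (M.Red φ) (M.Red φ) ℝ}

theorem nonempty_red (M : OpenMAS s p) (φ : Fin s) : Nonempty (M.Red φ) :=
  ⟨(⟨0, M.n_pos φ⟩, ⟨0, M.p_pos⟩)⟩

theorem lamMin_pos (hP : ∀ φ, (P φ).PosDef) (φ : Fin s) : 0 < lamMin (P φ) :=
  have := M.nonempty_red φ
  (hP φ).lamMin_pos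

theorem lamMax_pos (hP : ∀ φ, (P φ).PosDef) (φ : Fin s) : 0 < lamMax (P φ) :=
  have := M.nonempty_red φ
  (hP φ).lamMax_pos

theorem gain_pos (hP : ∀ φ, (P φ).PosDef) {U : ℝ} (hU : 0 < U) (φ φ' : Fin s) :
    0 < M.gain P U φ φ' := by
  have := M.lamMax_pos hP φ
  have := M.lamMin_pos hP φ'
  unfold gain
  positivity

theorem rate_neg (hP : ∀ φ, (P φ).PosDef) {γ : Fin s → ℝ} (hγs : ∀ φ ∈ M.Ps, γ φ < 0) {φ : Fin s}
    (hφ : φ ∈ M.Ps) : M.rate P γ φ < 0 := by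
  have h1 : -1 / lamMax (P φ) < 0 := div_neg_of_neg_of_pos (by norm_num) (M.lamMax_pos hP φ)
  have := hγs φ hφ
  rw [rate, if_pos hφ]
  linarith

/-- In a stable mode -‖x‖² is converted into extra decay through xᵀPx ≤ λ_max ‖x‖²; in an unstable
mode it is dropped. -/
theorem lyapunov_rate (hP : ∀ φ, (P φ).PosDef) (γ : Fin s → ℝ) (φ : Fin s)
    (x : EuclideanSpace ℝ (M.Red φ)) :
    2 * γ φ * quadForm (P φ) x - ‖x‖ ^ 2 ≤ M.rate P γ φ * quadForm (P φ) x := by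
  unfold rate
  split_ifs with h
  · have h1 := quadForm_le_lamMax (hP φ).isHermitian x
    have h2 := M.lamMax_pos hP φ
    have h3 : quadForm (P φ) x / lamMax (P φ) ≤ ‖x‖ ^ 2 := by
      rw [div_le_iff₀ h2]; linarith
    have h4 : (-1 / lamMax (P φ) + 2 * γ φ) * quadForm (P φ) x =
      2 * γ φ * quadForm (P φ) x - quadForm (P φ) x / lamMax (P φ) := by ring
    linarith
  · nlinarith [sq_nonneg ‖x‖]

section Eta

variable {U η₀ : ℝ} {χ : Fin s → Fin s → ℝ}

open Classical in
/-- Every decrease of `η` is undone at the next switching, so `η` is `η₀` except right after a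
transition to an unstable mode with gain at least one. -/
theorem eta_succ_eq (hσ : σ.QuasiAlternative M.Ps) (hP : ∀ φ, (P φ).PosDef) (hU : 0 < U)
    (hχ : ∀ φ φ', φ ∉ M.Ps → 0 < χ φ φ' ∧ χ φ φ' < 1) (k : ℕ) :
    M.eta σ P U η₀ χ (k + 1) =
      if σ.mode (k + 1) ∉ M.Ps ∧ 1 ≤ M.gain P U (σ.mode (k + 1)) (σ.mode k) then
        χ (σ.mode (k + 1)) (σ.mode k) * η₀ / M.gain P U (σ.mode (k + 1)) (σ.mode k)
      else η₀ := by
  induction k with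
  | zero => simp [eta]
  | succ k ih =>
    rw [eta]
    simp only [Nat.add_sub_cancel] at ih ⊢
    by_cases h1 : σ.mode (k + 1) ∉ M.Ps
    · have h2 : σ.mode (k + 1 + 1) ∈ M.Ps := hσ _ h1
      have h3 := (hχ _ (σ.mode k) h1).1.ne'
      have h4 := (M.gain_pos hP hU (σ.mode (k + 1)) (σ.mode k)).ne'
      by_cases h5 : 1 ≤ M.gain P U (σ.mode (k + 1)) (σ.mode k)
      -- The mode just left was unstable with gain at least one: the factor restored now is the
      -- inverse of the one applied before, and η₀ comes back.
      · rw [if_pos ⟨h1, h5⟩] at ih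
        rw [if_neg (fun h => h.1 h2), if_pos ⟨h2, h1, by omega, h5⟩, if_neg (fun h => h.1 h2), ih]
        field_simp
      · rw [if_neg (fun h => h5 h.2)] at ih
        rw [if_neg (fun h => h.1 h2), if_neg (fun h => h5 h.2.2.2), if_neg (fun h => h.1 h2), ih]
    · rw [if_neg (fun h => h1 h.1)] at ih
      rw [ih]
      by_cases h6 : σ.mode (k + 1 + 1) ∉ M.Ps ∧
          1 ≤ M.gain P U (σ.mode (k + 1 + 1)) (σ.mode (k + 1))
      · rw [if_pos h6, if_pos h6]
      · rw [if_neg h6, if_neg h6, if_neg (fun h => h1 h.2.1)]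

/-- By `eta_succ_eq`, η depends only on the current transition pair, of which there are finitely
many. The upper bound holds because χ < 1 ≤ gain whenever η is changed. -/
theorem exists_eta_bounds (hσ : σ.QuasiAlternative M.Ps) (hP : ∀ φ, (P φ).PosDef) (hU : 0 < U)
    (hη₀ : 0 < η₀) (hχ : ∀ φ φ', φ ∉ M.Ps → 0 < χ φ φ' ∧ χ φ φ' < 1) :
    ∃ e, 0 < e ∧ ∀ k, e ≤ M.eta σ P U η₀ χ k ∧ M.eta σ P U η₀ χ k ≤ η₀ := by
  classical
  have : Nonempty (Fin s × Fin s) := ⟨(σ.mode 0, σ.mode 0)⟩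
  let f : Fin s × Fin s → ℝ := fun q =>
    if q.1 ∉ M.Ps ∧ 1 ≤ M.gain P U q.1 q.2 then χ q.1 q.2 * η₀ / M.gain P U q.1 q.2 else η₀
  have hf : ∀ q, 0 < f q ∧ f q ≤ η₀ := by
    intro q
    simp only [f]
    split_ifs with h
    · obtain ⟨h1, h2⟩ := hχ q.1 q.2 h.1
      have h3 := M.gain_pos hP hU q.1 q.2
      refine ⟨by positivity, ?_⟩
      rw [div_le_iff₀ h3]
      nlinarith [mul_le_mul_of_nonneg_left h.2 hη₀.le]
    · exact ⟨hη₀, le_rfl⟩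
  obtain ⟨q, hq⟩ := Finite.exists_min f
  refine ⟨f q, (hf q).1, fun k => ?_⟩
  cases k with
  | zero => exact ⟨(hf q).2, le_rfl⟩
  | succ k =>
    rw [eta_succ_eq hσ hP hU hχ]
    exact ⟨hq (σ.mode (k + 1), σ.mode k), (hf (σ.mode (k + 1), σ.mode k)).2⟩

theorem eta_pos (hσ : σ.QuasiAlternative M.Ps) (hP : ∀ φ, (P φ).PosDef) (hU : 0 < U)
    (hη₀ : 0 < η₀) (hχ : ∀ φ φ', φ ∉ M.Ps → 0 < χ φ φ' ∧ χ φ φ' < 1) (k : ℕ) :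
    0 < M.eta σ P U η₀ χ k := by
  obtain ⟨e, he, h⟩ := exists_eta_bounds (σ := σ) hσ hP hU hη₀ hχ
  exact he.trans_le (h k).1

theorem le_Omega (hσ : σ.QuasiAlternative M.Ps) (hP : ∀ φ, (P φ).PosDef) (hU : 0 < U)
    (hη₀ : 0 < η₀) (hχ : ∀ φ φ', φ ∉ M.Ps → 0 < χ φ φ' ∧ χ φ φ' < 1) (k : ℕ) :
    2 * (M.eta σ P U η₀ χ (k + 1) * lamMax (P (σ.mode (k + 1)))) /
      (M.eta σ P U η₀ χ k * lamMin (P (σ.mode k))) * U ≤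
      M.Omega σ P U η₀ χ (σ.mode (k + 1)) (σ.mode k) := by
  -- A pair may occur infinitely often, so boundedness of the set is not automatic; it comes from
  -- the uniform bounds on η.
  refine le_csSup ?_ ⟨k, ⟨rfl, rfl⟩, rfl⟩
  obtain ⟨e, he, h⟩ := exists_eta_bounds (σ := σ) hσ hP hU hη₀ hχ
  refine ⟨2 * (η₀ * lamMax (P (σ.mode (k + 1)))) / (e * lamMin (P (σ.mode k))) * U, ?_⟩
  rintro w ⟨i, _, rfl⟩
  have h1 := M.lamMax_pos hP (σ.mode (k + 1))
  have h2 := M.lamMin_pos hP (σ.mode k)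
  have h3 := (h i).1
  have h4 := (h (i + 1)).2
  gcongr

theorem Omega_pos (hσ : σ.QuasiAlternative M.Ps) (hP : ∀ φ, (P φ).PosDef) (hU : 0 < U)
    (hη₀ : 0 < η₀) (hχ : ∀ φ φ', φ ∉ M.Ps → 0 < χ φ φ' ∧ χ φ φ' < 1) (k : ℕ) :
    0 < M.Omega σ P U η₀ χ (σ.mode (k + 1)) (σ.mode k) := by
  refine lt_of_lt_of_le ?_ (le_Omega hσ hP hU hη₀ hχ k)
  have h1 := M.lamMax_pos hP (σ.mode (k + 1))
  have h2 := M.lamMin_pos hP (σ.mode k)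
  have h3 := eta_pos (σ := σ) hσ hP hU hη₀ hχ k
  have h4 := eta_pos (σ := σ) hσ hP hU hη₀ hχ (k + 1)
  positivity

/-- The update of `η` makes every transition to an unstable mode contractive. -/
theorem log_Omega_neg (hσ : σ.QuasiAlternative M.Ps) (hP : ∀ φ, (P φ).PosDef) (hU : 0 < U)
    (hη₀ : 0 < η₀) (hχ : ∀ φ φ', φ ∉ M.Ps → 0 < χ φ φ' ∧ χ φ φ' < 1) {φ φ' : Fin s}
    (hT : ∃ k, σ.Transition φ φ' k) (hφ : φ ∉ M.Ps) :
    Real.log (M.Omega σ P U η₀ χ φ φ') < 0 := by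
  have hlt : M.Omega σ P U η₀ χ φ φ' < 1 := by
    -- A single r < 1 is needed, as a supremum of numbers below one could equal one. The ratio is
    -- exactly χ if the gain is at least one, and the gain itself otherwise.
    have hr : ∃ r < 1, ∀ k, σ.Transition φ φ' k →
        2 * (M.eta σ P U η₀ χ (k + 1) * lamMax (P φ)) /
          (M.eta σ P U η₀ χ k * lamMin (P φ')) * U ≤ r := by
      have h2 := (M.lamMin_pos hP φ').ne'
      have h1 := (M.lamMax_pos hP φ).ne'
      by_cases hg : 1 ≤ M.gain P U φ φ'
      · refine ⟨χ φ φ', (hχ φ φ' hφ).2, ?_⟩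
        rintro k ⟨rfl, rfl⟩
        have h3 := (eta_pos (σ := σ) hσ hP hU hη₀ hχ k).ne'
        rw [eta, if_pos ⟨hφ, hg⟩, gain]
        refine le_of_eq ?_
        field_simp
      · refine ⟨M.gain P U φ φ', not_le.1 hg, ?_⟩
        rintro k ⟨rfl, rfl⟩
        have h3 := (eta_pos (σ := σ) hσ hP hU hη₀ hχ k).ne'
        rw [eta, if_neg (fun h => hg h.2), if_neg (fun h => hφ h.1), gain]
        refine le_of_eq ?_
        field_simp
    obtain ⟨r, hr1, hr⟩ := hr
    refine lt_of_le_of_lt (csSup_le ?_ ?_) hr1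
    · obtain ⟨k, hk⟩ := hT
      exact ⟨_, k, hk, rfl⟩
    · rintro w ⟨k, hk, rfl⟩
      exact hr k hk
  obtain ⟨k, rfl, rfl⟩ := hT
  exact Real.log_neg (Omega_pos hσ hP hU hη₀ hχ k) hlt

end Eta

end OpenMAS

theorem hasDerivWithinAt_euclideanSpace {ι : Type*} [Fintype ι] {f : ℝ → EuclideanSpace ℝ ι}
    {f' : EuclideanSpace ℝ ι} {s : Set ℝ} {t : ℝ} :
    HasDerivWithinAt f f' s t ↔ ∀ i, HasDerivWithinAt (fun u => f u i) (f' i) s t := by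
  rw [hasDerivWithinAt_iff_hasFDerivWithinAt, hasFDerivWithinAt_euclidean]
  refine forall_congr' fun i => ?_
  rw [hasDerivWithinAt_iff_hasFDerivWithinAt]
  refine iff_of_eq ?_
  congr 1

/-! ### Scalar growth estimates -/

/-- Controls V inside an interval by its two ends, whatever the sign of the rate. -/
theorem exp_mul_le_max {g u L : ℝ} (hu : 0 ≤ u) (huL : u ≤ L) :
    Real.exp (g * u) ≤ max 1 (Real.exp (g * L)) := by
  rcases le_total g 0 with hg | hg
  · exact le_max_of_le_left (Real.exp_le_one_iff.2 (mul_nonpos_of_nonpos_of_nonneg hg hu))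
  · exact le_max_of_le_right (Real.exp_le_exp.2 (mul_le_mul_of_nonneg_left huL hg))

theorem le_geometric_add {a : ℕ → ℝ} {q E : ℝ} (hq : 0 ≤ q) (hq1 : q < 1) (hE : 0 ≤ E)
    (h : ∀ k, a (k + 1) ≤ q * a k + E) (k : ℕ) : a k ≤ q ^ k * a 0 + E / (1 - q) := by
  have h1 : 0 < 1 - q := by linarith
  induction k with
  | zero => simp; positivity
  | succ k ih =>
    have h2 := mul_le_mul_of_nonneg_left ih hq
    have h3 : q * (E / (1 - q)) + E = E / (1 - q) := by field_simp; ring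
    calc a (k + 1) ≤ q * (q ^ k * a 0 + E / (1 - q)) + E := by linarith [h k]
      _ = q ^ (k + 1) * a 0 + (q * (E / (1 - q)) + E) := by ring
      _ = _ := by rw [h3]

theorem le_half_pow_mul_exp_sum {a w : ℕ → ℝ}
    (h : ∀ k, a (k + 1) ≤ 1 / 2 * Real.exp (w k) * a k) (k : ℕ) :
    a k ≤ (1 / 2) ^ k * Real.exp (∑ i ∈ Finset.range k, w i) * a 0 := by
  induction k with
  | zero => simp
  | succ k ih =>
    refine (h k).trans ((mul_le_mul_of_nonneg_left ih (by positivity)).trans (le_of_eq ?_))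
    rw [Finset.sum_range_succ, Real.exp_add]
    ring

/-- The gap to (‖x‖ + ‖y‖)² is ½(‖x‖ - 2‖y‖)². The weight on x must stay below 2, so that with the ½
of the jump estimate a contraction remains. -/
theorem norm_add_sq_le {E : Type*} [SeminormedAddCommGroup E] (x y : E) :
    ‖x + y‖ ^ 2 ≤ 3 / 2 * ‖x‖ ^ 2 + 3 * ‖y‖ ^ 2 := by
  have h := norm_add_le x y
  have h0 := norm_nonneg (x + y)
  nlinarith [sq_nonneg (‖x‖ - 2 * ‖y‖)]

namespace OpenMAS

variable {s p : ℕ} {M : OpenMAS s p} {σ : SwitchingSignal s}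

/-! ### The disagreement dynamics -/

/-- The Laplacian annihilates constants, so the state of the last agent may be subtracted; its own
term then vanishes. -/
theorem sum_adj_mul_sub (φ : Fin s) (x : Fin (M.n φ + 1) → ℝ) (i : Fin (M.n φ + 1)) :
    ∑ j, M.adj φ i j * (x i - x j) =
      ∑ j : Fin (M.n φ), M.lap φ i j.castSucc * (x j.castSucc - x (Fin.last _)) := by
  have h : ∑ j, M.lap φ i j * (x j - x (Fin.last _)) = ∑ j, M.adj φ i j * (x i - x j) := by
    simp only [lap, Matrix.sub_apply, Matrix.diagonal_apply, sub_mul, Finset.sum_sub_distrib,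
      ite_mul, zero_mul, Finset.sum_ite_eq, Finset.mem_univ, if_true, Finset.sum_mul]
    rw [← Finset.sum_sub_distrib]
    exact Finset.sum_congr rfl fun j _ => by ring
  rw [← h, Fin.sum_univ_castSucc]
  simp

theorem mulE_A_apply (φ : Fin s) (d : EuclideanSpace ℝ (M.Red φ)) (i : Fin (M.n φ)) (a : Fin p) :
    mulE (M.A φ) d (i, a) =
      ∑ b, M.S a b * d (i, b) - M.rho * ∑ j, M.Z φ i j * d (j, a) := by
  simp only [mulE, A, Matrix.mulVec, dotProduct, Fintype.sum_prod_type, Matrix.sub_apply,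
    Matrix.smul_apply, Matrix.kroneckerMap_apply, Matrix.one_apply, smul_eq_mul, sub_mul,
    Finset.sum_sub_distrib, ite_mul, one_mul, zero_mul, mul_ite, mul_one, mul_zero,
    Finset.sum_ite_eq, Finset.mem_univ, if_true]
  congr 1
  · rw [Finset.sum_eq_single i]
    · simp
    · intro b _ hb; simp [hb.symm]
    · simp
  · rw [Finset.mul_sum]
    exact Finset.sum_congr rfl fun j _ => by ring

theorem dis_add {φ : Fin s} (x y : EuclideanSpace ℝ (M.Full φ)) :
    M.dis (x + y) = M.dis x + M.dis y := by
  ext i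
  simp only [dis, PiLp.add_apply]
  ring

theorem isLinearMDSSTrajectory_dis {Φ : ∀ k, EuclideanSpace ℝ (M.Full (σ.mode (k + 1)))}
    {ξ : ∀ k, ℝ → EuclideanSpace ℝ (M.Full (σ.mode k))} (h : M.IsTrajectory σ Φ ξ) :
    IsLinearMDSSTrajectory σ M.Red M.A M.XiRed
      (fun k => M.jumpRed (ξ k (σ.instant (k + 1))) (Φ k)) (fun k t => M.dis (ξ k t)) := by
  refine ⟨fun φ φ' i j => ?_, fun k t ht => ?_, fun k => ?_⟩
  · simp only [XiRed, Xi, Matrix.of_apply]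
    split_ifs <;> simp
  · rw [hasDerivWithinAt_euclideanSpace]
    rintro ⟨i, a⟩
    have hi := fun i => hasDerivWithinAt_euclideanSpace.1 (h.1 k t ht i) a
    -- Subtracting the equation of the last agent produces the coefficients l_ij - l_Nj, that is,
    -- `Z`.
    have hd := (hi i.castSucc).sub (hi (Fin.last _))
    convert! hd using 1
    rw [mulE_A_apply]
    have hs := fun i => M.sum_adj_mul_sub (σ.mode k) (fun j => ξ k t (j, a)) i
    simp only [PiLp.sub_apply, PiLp.smul_apply, WithLp.ofLp_sum, Finset.sum_apply, agent, mulE,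
      Matrix.mulVec, dotProduct, smul_eq_mul]
    rw [hs, hs]
    simp only [dis, Z, Matrix.of_apply, sub_mul, mul_sub, Finset.sum_sub_distrib]
    ring
  · simp only
    rw [h.2 k, dis_add, jumpRed]
    abel

/-! ### Lyapunov functions -/

theorem norm2_sq_le_upsilon (Q : ∀ φ φ', Matrix (M.Red φ) (M.Red φ') ℝ) (φ φ' : Fin s) :
    norm2 (Q φ φ') ^ 2 ≤ M.upsilon Q :=
  le_max_of_le_right ((le_ciSup (f := fun φ' => norm2 (Q φ φ') ^ 2)
    (Set.finite_range _).bddAbove φ').trans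
      (le_ciSup (f := fun φ => ⨆ φ', norm2 (Q φ φ') ^ 2) (Set.finite_range _).bddAbove φ))

theorem upsilon_pos (Q : ∀ φ φ', Matrix (M.Red φ) (M.Red φ') ℝ) : 0 < M.upsilon Q :=
  zero_lt_one.trans_le (le_max_left _ _)

theorem norm_mulE_sq_le_upsilon (Q : ∀ φ φ', Matrix (M.Red φ) (M.Red φ') ℝ) {φ φ' : Fin s}
    (d : EuclideanSpace ℝ (M.Red φ')) : ‖mulE (Q φ φ') d‖ ^ 2 ≤ M.upsilon Q * ‖d‖ ^ 2 := by
  calc ‖mulE (Q φ φ') d‖ ^ 2 ≤ (norm2 (Q φ φ') * ‖d‖) ^ 2 :=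
        pow_le_pow_left₀ (norm_nonneg _) (norm_mulE_le _ _) 2
    _ = norm2 (Q φ φ') ^ 2 * ‖d‖ ^ 2 := mul_pow _ _ _
    _ ≤ _ := mul_le_mul_of_nonneg_right (norm2_sq_le_upsilon Q φ φ') (sq_nonneg _)

variable {P : ∀ φ, Matrix (M.Red φ) (M.Red φ) ℝ} {γ : Fin s → ℝ}
  {U η₀ : ℝ} {χ : Fin s → Fin s → ℝ}

variable (M σ P U η₀ χ) in
/-- The multiple Lyapunov function `η_k δᵀ P_{σ_k} δ`. -/
noncomputable def lyapunov (ξ : ∀ k, ℝ → EuclideanSpace ℝ (M.Full (σ.mode k))) (k : ℕ) (t : ℝ) : ℝ :=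
  M.eta σ P U η₀ χ k * quadForm (P (σ.mode k)) (M.dis (ξ k t))

variable {Φ : ∀ k, EuclideanSpace ℝ (M.Full (σ.mode (k + 1)))}
  {ξ : ∀ k, ℝ → EuclideanSpace ℝ (M.Full (σ.mode k))}

section

variable (hσ : σ.QuasiAlternative M.Ps) (hP : ∀ φ, (P φ).PosDef) (hU : 0 < U)
  (hη₀ : 0 < η₀) (hχ : ∀ φ φ', φ ∉ M.Ps → 0 < χ φ φ' ∧ χ φ φ' < 1)

include hσ hP hU hη₀ hχ

theorem exists_mul_norm_sq_le_lyapunov :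
    ∃ c, 0 < c ∧ ∀ (ξ : ∀ k, ℝ → EuclideanSpace ℝ (M.Full (σ.mode k))) k t,
      c * ‖M.dis (ξ k t)‖ ^ 2 ≤ M.lyapunov σ P U η₀ χ ξ k t := by
  have : Nonempty (Fin s) := ⟨σ.mode 0⟩
  obtain ⟨φ, hφ⟩ := Finite.exists_min fun φ => lamMin (P φ)
  obtain ⟨e, he, h⟩ := exists_eta_bounds (σ := σ) hσ hP hU hη₀ hχ
  have h0 := M.lamMin_pos hP φ
  refine ⟨e * lamMin (P φ), mul_pos he h0, fun ξ k t => ?_⟩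
  rw [mul_assoc]
  refine mul_le_mul (h k).1 ?_ (by positivity) (he.le.trans (h k).1)
  exact (mul_le_mul_of_nonneg_right (hφ _) (sq_nonneg _)).trans
    (lamMin_le_quadForm (hP _).isHermitian _)

theorem lyapunov_nonneg (k : ℕ) (t : ℝ) : 0 ≤ M.lyapunov σ P U η₀ χ ξ k t := by
  obtain ⟨c, hc, h⟩ := exists_mul_norm_sq_le_lyapunov (σ := σ) hσ hP hU hη₀ hχ
  exact (by positivity : 0 ≤ c * ‖M.dis (ξ k t)‖ ^ 2).trans (h ξ k t)

theorem lyapunov_flow_le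
    (hLyap : ∀ φ, (M.A φ).transpose * P φ + P φ * M.A φ - (2 * γ φ) • P φ = -1)
    (h : M.IsTrajectory σ Φ ξ) {k : ℕ} {t : ℝ}
    (ht : t ∈ Icc (σ.instant k) (σ.instant (k + 1))) :
    M.lyapunov σ P U η₀ χ ξ k t ≤
      Real.exp (M.rate P γ (σ.mode k) * (t - σ.instant k)) *
        M.lyapunov σ P U η₀ χ ξ k (σ.instant k) := by
  have h1 := quadForm_flow_le (hLyap (σ.mode k)) (lyapunov_rate hP γ (σ.mode k))
    ((isLinearMDSSTrajectory_dis h).2.1 k) ht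
  have h2 := mul_le_mul_of_nonneg_left h1 (eta_pos (σ := σ) hσ hP hU hη₀ hχ k).le
  unfold lyapunov
  linarith

/-- The common core of both jump estimates: ‖δ‖² is traded for V through λ_min, and the factor 2 in
`Omega` becomes the ½ here. -/
theorem eta_mul_lamMax_mul_le (k : ℕ) (t : ℝ) :
    M.eta σ P U η₀ χ (k + 1) * (lamMax (P (σ.mode (k + 1))) * (U * ‖M.dis (ξ k t)‖ ^ 2)) ≤
      1 / 2 * M.Omega σ P U η₀ χ (σ.mode (k + 1)) (σ.mode k) *
        M.lyapunov σ P U η₀ χ ξ k t := by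
  have h1 := M.lamMax_pos hP (σ.mode (k + 1))
  have h2 := M.lamMin_pos hP (σ.mode k)
  have h3 := eta_pos (σ := σ) hσ hP hU hη₀ hχ k
  have h4 := eta_pos (σ := σ) hσ hP hU hη₀ hχ (k + 1)
  have h5 := mul_le_mul_of_nonneg_left
    (lamMin_le_quadForm (hP (σ.mode k)).isHermitian (M.dis (ξ k t))) h3.le
  have h6 := le_Omega (σ := σ) hσ hP hU hη₀ hχ k
  have h7 := Omega_pos (σ := σ) hσ hP hU hη₀ hχ k
  calc _ = 1 / 2 * (2 * (M.eta σ P U η₀ χ (k + 1) * lamMax (P (σ.mode (k + 1)))) /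
      (M.eta σ P U η₀ χ k * lamMin (P (σ.mode k))) * U) *
      (M.eta σ P U η₀ χ k * (lamMin (P (σ.mode k)) * ‖M.dis (ξ k t)‖ ^ 2)) := by
        field_simp
    _ ≤ _ := by
        refine mul_le_mul (mul_le_mul_of_nonneg_left h6 (by norm_num)) h5 (by positivity)
          (by positivity)

end

/-! ### From Lyapunov estimates to consensus -/

theorem norm_agent_sub_last_le {φ : Fin s} (x : EuclideanSpace ℝ (M.Full φ))
    (i : Fin (M.n φ + 1)) : ‖M.agent x i - M.agent x (Fin.last _)‖ ≤ ‖M.dis x‖ := by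
  refine Fin.lastCases ?_ (fun i => ?_) i
  · simp
  · rw [EuclideanSpace.norm_eq, EuclideanSpace.norm_eq]
    refine Real.sqrt_le_sqrt ?_
    rw [Fintype.sum_prod_type]
    exact Finset.single_le_sum (f := fun i => ∑ a, ‖M.dis x (i, a)‖ ^ 2)
      (fun _ _ => Finset.sum_nonneg fun _ _ => sq_nonneg _) (Finset.mem_univ i)

theorem norm_agent_sub_le {φ : Fin s} (x : EuclideanSpace ℝ (M.Full φ))
    (i j : Fin (M.n φ + 1)) : ‖M.agent x i - M.agent x j‖ ≤ 2 * ‖M.dis x‖ := by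
  have h1 := norm_agent_sub_last_le x i
  have h2 := norm_agent_sub_last_le x j
  have h3 := norm_sub_le_norm_sub_add_norm_sub (M.agent x i) (M.agent x (Fin.last _)) (M.agent x j)
  rw [norm_sub_rev (M.agent x (Fin.last _))] at h3
  linarith

theorem ultimateDisagreementLE_of_tendsto {b : ℕ → ℝ} {β : ℝ} (hb : Tendsto b atTop (𝓝 β))
    (h : ∀ k, ∀ t ∈ Ico (σ.instant (k + 1)) (σ.instant (k + 2)),
      ‖M.dis (ξ (k + 1) t)‖ ^ 2 ≤ b k) :
    M.UltimateDisagreementLE σ ξ (2 * Real.sqrt β) := by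
  intro ε' hε'
  have h1 : ∀ᶠ k in atTop, 2 * Real.sqrt (b k) < ε' :=
    (((Real.continuous_sqrt.tendsto β).comp hb).const_mul 2).eventually_lt_const hε'
  obtain ⟨K, hK⟩ := eventually_atTop.1 h1
  filter_upwards [eventually_ge_atTop (σ.instant (K + 1))] with t ht k hk i j
  -- The bounds start with the interval after the first switching, hence the shift by one.
  have hKk : K + 1 < k + 1 := σ.instant_strictMono.lt_iff_lt.1 (ht.trans_lt hk.2)
  obtain ⟨k, rfl⟩ : ∃ l, k = l + 1 := ⟨k - 1, by omega⟩
  have h2 := hK k (by omega)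
  have h3 := Real.le_sqrt_of_sq_le (h k t hk)
  have h4 := norm_agent_sub_le (ξ (k + 1) t) i j
  linarith

/-- Bounds on the occurring jump gains that are uniform over all transitions. -/
theorem exists_gain_bound (Ω : Fin s → Fin s → ℝ) :
    ∃ B, 1 ≤ B ∧ ∀ φ φ', Ω φ φ' ≤ B ∧ (Ω φ φ')⁻¹ ≤ B := by
  obtain ⟨B, hB⟩ := (Set.finite_range fun q : Fin s × Fin s =>
    max (Ω q.1 q.2) (Ω q.1 q.2)⁻¹).bddAbove
  refine ⟨max 1 B, le_max_left _ _, fun φ φ' => ?_⟩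
  have h := hB ⟨(φ, φ'), rfl⟩
  exact ⟨le_max_of_le_right ((le_max_left _ _).trans h),
    le_max_of_le_right ((le_max_right _ _).trans h)⟩

/-! ### Consensus for linear jumps, practical consensus for bounded jumps. -/

section

variable (hσ : σ.QuasiAlternative M.Ps) (hγs : ∀ φ ∈ M.Ps, γ φ < 0) (hP : ∀ φ, (P φ).PosDef)
  (hLyap : ∀ φ, (M.A φ).transpose * P φ + P φ * M.A φ - (2 * γ φ) • P φ = -1)
  (hη₀ : 0 < η₀) (hχ : ∀ φ φ', φ ∉ M.Ps → 0 < χ φ φ' ∧ χ φ φ' < 1)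

include hσ hγs hP hLyap hη₀ hχ

theorem consensus_of_linear_jumps {XiHat : ∀ φ φ', Matrix (M.Red φ) (M.Red φ') ℝ}
    {τ : Fin s → Fin s → ℝ}
    (hτ : σ.TDADTCondition M.Ps (M.rate P γ)
      (M.Omega σ P (M.upsilon fun φ φ' => M.XiRed φ φ' + XiHat φ φ') η₀ χ) τ)
    (h : M.IsTrajectory σ Φ ξ)
    (hjump : ∀ k, M.jumpRed (ξ k (σ.instant (k + 1))) (Φ k) =
      mulE (XiHat (σ.mode (k + 1)) (σ.mode k)) (M.dis (ξ k (σ.instant (k + 1))))) :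
    M.UltimateDisagreementLE σ ξ 0 := by
  set Q : ∀ φ φ', Matrix (M.Red φ) (M.Red φ') ℝ := fun φ φ' => M.XiRed φ φ' + XiHat φ φ'
  have hU := M.upsilon_pos Q
  set U := M.upsilon Q
  set Ω := M.Omega σ P U η₀ χ
  set V := M.lyapunov σ P U η₀ χ ξ
  set g := M.rate P γ
  have hVnn : ∀ k t, 0 ≤ V k t := lyapunov_nonneg hσ hP hU hη₀ hχ
  have hΩpos : ∀ k, 0 < Ω (σ.mode (k + 1)) (σ.mode k) := Omega_pos hσ hP hU hη₀ hχ
  have hVjump : ∀ k, V (k + 1) (σ.instant (k + 1)) ≤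
      1 / 2 * Ω (σ.mode (k + 1)) (σ.mode k) * V k (σ.instant (k + 1)) := by
    intro k
    refine le_trans ?_ (eta_mul_lamMax_mul_le hσ hP hU hη₀ hχ k (σ.instant (k + 1)))
    have h1 := (isLinearMDSSTrajectory_dis h).2.2 k
    simp only at h1
    rw [hjump, ← add_mulE] at h1
    refine mul_le_mul_of_nonneg_left ?_ (eta_pos hσ hP hU hη₀ hχ _).le
    refine (quadForm_le_lamMax (hP _).isHermitian _).trans ?_
    rw [h1]
    exact mul_le_mul_of_nonneg_left (norm_mulE_sq_le_upsilon Q _) (M.lamMax_pos hP _).le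
  obtain ⟨B, hB1, hB⟩ := exists_gain_bound Ω
  obtain ⟨c, hc, hcV⟩ := exists_mul_norm_sq_le_lyapunov (σ := σ) hσ hP hU hη₀ hχ
  obtain ⟨C, hC⟩ := hτ.exists_sum_le (fun φ hφ => rate_neg hP hγs hφ)
    (fun φ φ' hT hφ => log_Omega_neg hσ hP hU hη₀ hχ hT hφ)
  set w : ℕ → ℝ := fun k => Real.log (Ω (σ.mode (k + 1)) (σ.mode k)) +
    g (σ.mode (k + 1)) * (σ.instant (k + 2) - σ.instant (k + 1))
  have hw : ∀ k, Real.exp (w k) = Ω (σ.mode (k + 1)) (σ.mode k) *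
      Real.exp (g (σ.mode (k + 1)) * (σ.instant (k + 2) - σ.instant (k + 1))) := by
    intro k
    rw [Real.exp_add, Real.exp_log (hΩpos k)]
  -- Sampling just before each switching makes one step a jump followed by a full flow, whose
  -- logarithmic growth is `w k` apart from the factor ½.
  set a : ℕ → ℝ := fun k => V k (σ.instant (k + 1))
  have ha : ∀ k, a (k + 1) ≤ 1 / 2 * Real.exp (w k) * a k := by
    intro k
    have h1 := lyapunov_flow_le hσ hP hU hη₀ hχ hLyap h
      (right_mem_Icc.2 (sub_nonneg.1 (σ.length_pos (k + 1)).le))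
    refine h1.trans ((mul_le_mul_of_nonneg_left (hVjump k) (Real.exp_pos _).le).trans
      (le_of_eq ?_))
    rw [hw]
    ring
  have haK : ∀ k, a k ≤ (1 / 2) ^ k * (Real.exp C * a 0) := by
    intro k
    refine (le_half_pow_mul_exp_sum ha k).trans ?_
    rw [mul_assoc]
    have h1 := Real.exp_le_exp.2 (hC k)
    have h2 : 0 ≤ a 0 := hVnn _ _
    gcongr
  -- `C` bounds partial sums, not a single `w k`, so the last factor is absorbed into the sum up to
  -- k + 1 instead of being estimated alone.
  have hstep : ∀ k, 1 / 2 * Real.exp (w k) * a k ≤ (1 / 2) ^ (k + 1) * (Real.exp C * a 0) := by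
    intro k
    have h1 := Real.exp_le_exp.2 (hC (k + 1))
    have h2 : 0 ≤ a 0 := hVnn _ _
    calc 1 / 2 * Real.exp (w k) * a k
        ≤ 1 / 2 * Real.exp (w k) * ((1 / 2) ^ k * Real.exp (∑ i ∈ Finset.range k, w i) * a 0) :=
          mul_le_mul_of_nonneg_left (le_half_pow_mul_exp_sum ha k) (by positivity)
      _ = (1 / 2) ^ (k + 1) * (Real.exp (∑ i ∈ Finset.range (k + 1), w i) * a 0) := by
          rw [Finset.sum_range_succ, Real.exp_add (∑ i ∈ Finset.range k, w i)]; ring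
      _ ≤ _ := by gcongr
  have hlim : Tendsto (fun k : ℕ => (1 / 2 : ℝ) ^ k * ((B + 1) / 2 * (Real.exp C * a 0) / c))
      atTop (𝓝 0) := by
    have := (tendsto_pow_atTop_nhds_zero_of_lt_one (r := (1 / 2 : ℝ)) (by norm_num)
      (by norm_num)).mul_const ((B + 1) / 2 * (Real.exp C * a 0) / c)
    rwa [zero_mul] at this
  have hfin := ultimateDisagreementLE_of_tendsto (ξ := ξ) hlim ?_
  · simpa using hfin
  intro k t ht
  have h1 := lyapunov_flow_le hσ hP hU hη₀ hχ hLyap h (Ico_subset_Icc_self ht)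
  have h2 := exp_mul_le_max (g := g (σ.mode (k + 1))) (sub_nonneg.2 ht.1)
    (sub_le_sub_right ht.2.le (σ.instant (k + 1)))
  have h3 := h1.trans (mul_le_mul h2 (hVjump k) (hVnn _ _) (zero_le_one.trans (le_max_left _ _)))
  -- The maximum becomes a sum: the term 1 is handled by Ω ≤ `B`, the exponential by `hstep`.
  have h4 : max 1 (Real.exp (g (σ.mode (k + 1)) * (σ.instant (k + 2) - σ.instant (k + 1)))) ≤
      1 + Real.exp (g (σ.mode (k + 1)) * (σ.instant (k + 2) - σ.instant (k + 1))) :=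
    max_le (by linarith [Real.exp_pos (g (σ.mode (k + 1)) *
      (σ.instant (k + 2) - σ.instant (k + 1)))]) (by linarith)
  have hak : 0 ≤ a k := hVnn _ _
  have h5 := h3.trans (mul_le_mul_of_nonneg_right h4
    (mul_nonneg (mul_nonneg (by norm_num) (hΩpos k).le) hak))
  have h6 : (1 + Real.exp (g (σ.mode (k + 1)) * (σ.instant (k + 2) - σ.instant (k + 1)))) *
      (1 / 2 * Ω (σ.mode (k + 1)) (σ.mode k) * a k) =
      1 / 2 * (Ω (σ.mode (k + 1)) (σ.mode k) * a k) + 1 / 2 * Real.exp (w k) * a k := by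
    rw [hw]; ring
  have h7 : Ω (σ.mode (k + 1)) (σ.mode k) * a k ≤ B * ((1 / 2) ^ k * (Real.exp C * a 0)) :=
    mul_le_mul (hB _ _).1 (haK k) hak (by linarith)
  have h8 := hstep k
  have h9 := hcV ξ (k + 1) t
  rw [mul_div_assoc', le_div_iff₀ hc]
  have h10 : (1 / 2 : ℝ) ^ k * ((B + 1) / 2 * (Real.exp C * a 0)) =
      1 / 2 * (B * ((1 / 2) ^ k * (Real.exp C * a 0))) +
        (1 / 2) ^ (k + 1) * (Real.exp C * a 0) := by ring
  rw [h6] at h5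
  linarith

theorem practical_consensus_of_bounded_jumps
    (hpw : σ.PiecewiseTDADTCondition M.Ps (M.rate P γ)
      (M.Omega σ P (M.upsilon M.XiRed) η₀ χ)) {Φbar : ℝ} (hΦbar : 0 < Φbar) :
    ∃ ε : ℝ, 0 ≤ ε ∧
      ∀ Φred : ∀ k, EuclideanSpace ℝ (M.Red (σ.mode (k + 1))), (∀ k, ‖Φred k‖ ≤ Φbar) →
      ∀ Φ ξ, M.IsTrajectory σ Φ ξ →
        (∀ k, M.jumpRed (ξ k (σ.instant (k + 1))) (Φ k) = Φred k) →
        M.UltimateDisagreementLE σ ξ ε := by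
  have hU := M.upsilon_pos M.XiRed
  set U := M.upsilon M.XiRed
  set Ω := M.Omega σ P U η₀ χ
  set g := M.rate P γ
  obtain ⟨B, hB1, hB⟩ := exists_gain_bound Ω
  obtain ⟨c, hc, hcV⟩ := exists_mul_norm_sq_le_lyapunov (σ := σ) hσ hP hU hη₀ hχ
  obtain ⟨e, he, hη⟩ := exists_eta_bounds (σ := σ) hσ hP hU hη₀ hχ
  obtain ⟨φm, hφm⟩ := haveI : Nonempty (Fin s) := ⟨σ.mode 0⟩
    Finite.exists_max fun φ => lamMax (P φ)
  have hlm := M.lamMax_pos hP φm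
  -- Largest additive contribution of a jump to V; the 3 is the weight in `norm_add_sq_le`.
  set D : ℝ := 3 * (η₀ * lamMax (P φm) * Φbar ^ 2)
  have hD0 : 0 ≤ D := by positivity
  -- Here 4BD = BD / (1 - 3/4) is the fixed point of the recursion for `a`, the rest covers one
  -- further jump and partial flow. Everything is fixed before the trajectory is chosen.
  refine ⟨2 * Real.sqrt ((3 / 4 * B * (4 * (B * D)) + B * D) / c), by positivity, ?_⟩
  intro Φred hΦred Φ ξ h hjump
  set V := M.lyapunov σ P U η₀ χ ξ
  have hVnn : ∀ k t, 0 ≤ V k t := lyapunov_nonneg hσ hP hU hη₀ hχ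
  have hΩpos : ∀ k, 0 < Ω (σ.mode (k + 1)) (σ.mode k) := Omega_pos hσ hP hU hη₀ hχ
  set a : ℕ → ℝ := fun k => V k (σ.instant (k + 1))
  have hVjump : ∀ k, V (k + 1) (σ.instant (k + 1)) ≤
      3 / 4 * Ω (σ.mode (k + 1)) (σ.mode k) * a k + D := by
    intro k
    have h0 := eta_mul_lamMax_mul_le (ξ := ξ) hσ hP hU hη₀ hχ k (σ.instant (k + 1))
    have h1 := (isLinearMDSSTrajectory_dis h).2.2 k
    simp only at h1
    rw [hjump] at h1
    set d := M.dis (ξ k (σ.instant (k + 1)))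
    have h2 := norm_add_sq_le (mulE (M.XiRed (σ.mode (k + 1)) (σ.mode k)) d) (Φred k)
    have h3 := norm_mulE_sq_le_upsilon M.XiRed (φ := σ.mode (k + 1)) d
    have h4 : ‖Φred k‖ ^ 2 ≤ Φbar ^ 2 := pow_le_pow_left₀ (norm_nonneg _) (hΦred k) 2
    have h5 : ‖M.dis (ξ (k + 1) (σ.instant (k + 1)))‖ ^ 2 ≤
        3 / 2 * (U * ‖d‖ ^ 2) + 3 * Φbar ^ 2 := by
      rw [h1]; linarith
    have hη0 := eta_pos (σ := σ) hσ hP hU hη₀ hχ (k + 1)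
    have hl0 := M.lamMax_pos hP (σ.mode (k + 1))
    have h6 : V (k + 1) (σ.instant (k + 1)) ≤ M.eta σ P U η₀ χ (k + 1) *
        (lamMax (P (σ.mode (k + 1))) * (3 / 2 * (U * ‖d‖ ^ 2) + 3 * Φbar ^ 2)) :=
      mul_le_mul_of_nonneg_left ((quadForm_le_lamMax (hP _).isHermitian _).trans
        (mul_le_mul_of_nonneg_left h5 hl0.le)) hη0.le
    have h7 : M.eta σ P U η₀ χ (k + 1) * lamMax (P (σ.mode (k + 1))) * Φbar ^ 2 ≤
        η₀ * lamMax (P φm) * Φbar ^ 2 :=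
      mul_le_mul_of_nonneg_right (mul_le_mul (hη _).2 (hφm _) hl0.le hη₀.le) (sq_nonneg _)
    simp only [a, V]
    linarith
  have hE : ∀ k, Real.exp (g (σ.mode (k + 1)) * (σ.instant (k + 2) - σ.instant (k + 1))) *
      Ω (σ.mode (k + 1)) (σ.mode k) ≤ 1 := by
    intro k
    have h1 := hpw.log_add_le (fun φ hφ => rate_neg hP hγs hφ)
      (fun φ φ' hT hφ => log_Omega_neg hσ hP hU hη₀ hχ hT hφ) k
    rw [← Real.exp_le_one_iff, Real.exp_add, Real.exp_log (hΩpos k), mul_comm] at h1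
    exact h1
  -- The additive term `D` meets the flow without the factor Ω, so the flow alone must be bounded;
  -- `hE` gives Ω⁻¹.
  have hEB : ∀ k, Real.exp (g (σ.mode (k + 1)) * (σ.instant (k + 2) - σ.instant (k + 1))) ≤ B := by
    intro k
    refine le_trans ?_ (hB (σ.mode (k + 1)) (σ.mode k)).2
    rw [← one_div, le_div_iff₀ (hΩpos k)]
    exact hE k
  have ha : ∀ k, a (k + 1) ≤ 3 / 4 * a k + B * D := by
    intro k
    have h1 := lyapunov_flow_le hσ hP hU hη₀ hχ hLyap h
      (right_mem_Icc.2 (sub_nonneg.1 (σ.length_pos (k + 1)).le))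
    have h2 := h1.trans (mul_le_mul_of_nonneg_left (hVjump k) (Real.exp_pos _).le)
    have h3 := mul_le_mul_of_nonneg_right (hE k) (hVnn k (σ.instant (k + 1)))
    have h4 := mul_le_mul_of_nonneg_right (hEB k) hD0
    simp only [a, V] at *
    linarith
  have haK : ∀ k, a k ≤ (3 / 4) ^ k * a 0 + 4 * (B * D) := by
    intro k
    have h1 := le_geometric_add (by norm_num) (by norm_num) (by positivity) ha k
    have h2 : B * D / (1 - 3 / 4) = 4 * (B * D) := by ring
    linarith
  have hlim : Tendsto (fun k : ℕ => (3 / 4 * B * ((3 / 4) ^ k * a 0 + 4 * (B * D)) + B * D) / c)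
      atTop (𝓝 ((3 / 4 * B * (4 * (B * D)) + B * D) / c)) := by
    have h1 := (tendsto_pow_atTop_nhds_zero_of_lt_one (r := (3 / 4 : ℝ)) (by norm_num)
      (by norm_num)).mul_const (a 0)
    have h2 := ((((h1.add_const (4 * (B * D))).const_mul (3 / 4 * B)).add_const (B * D)).div_const c)
    rwa [zero_mul, zero_add] at h2
  refine ultimateDisagreementLE_of_tendsto hlim fun k t ht => ?_
  have h1 := lyapunov_flow_le hσ hP hU hη₀ hχ hLyap h (Ico_subset_Icc_self ht)
  have h2 := exp_mul_le_max (g := g (σ.mode (k + 1))) (sub_nonneg.2 ht.1)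
    (sub_le_sub_right ht.2.le (σ.instant (k + 1)))
  have h3 := h1.trans (mul_le_mul h2 (hVjump k) (hVnn _ _) (zero_le_one.trans (le_max_left _ _)))
  set m := max 1 (Real.exp (g (σ.mode (k + 1)) * (σ.instant (k + 2) - σ.instant (k + 1))))
  have h4 : m * Ω (σ.mode (k + 1)) (σ.mode k) ≤ B := by
    rcases max_choice 1
      (Real.exp (g (σ.mode (k + 1)) * (σ.instant (k + 2) - σ.instant (k + 1)))) with h | h
    · simp only [m, h, one_mul]; exact (hB _ _).1
    · simp only [m, h]; exact (hE k).trans hB1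
  have h5 : m ≤ B := max_le hB1 (hEB k)
  have h6 := mul_le_mul h4 (haK k) (hVnn _ _) (zero_le_one.trans hB1)
  have h7 := mul_le_mul_of_nonneg_right h5 hD0
  have h9 := hcV ξ (k + 1) t
  rw [le_div_iff₀ hc]
  linarith

end

end OpenMAS

theorem theorem3 {s p : ℕ} (M : OpenMAS s p) (σ : SwitchingSignal s)
    (hσ : σ.QuasiAlternative M.Ps)
    -- parameters of the Lyapunov functions
    (γ : Fin s → ℝ)
    (hγ : ∀ φ, ∀ z ∈ spectrum ℂ ((M.A φ).map (algebraMap ℝ ℂ)), z.re < γ φ)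
    (hγs : ∀ φ ∈ M.Ps, γ φ < 0)
    (P : ∀ φ, Matrix (M.Red φ) (M.Red φ) ℝ) (hP : ∀ φ, (P φ).PosDef)
    (hLyap : ∀ φ, (M.A φ).transpose * P φ + P φ * M.A φ - (2 * γ φ) • P φ = -1)
    (η₀ : ℝ) (hη₀ : 0 < η₀) (χ : Fin s → Fin s → ℝ)
    (hχ : ∀ φ φ', φ ∉ M.Ps → 0 < χ φ φ' ∧ χ φ φ' < 1) :
    -- the disagreement dynamics form an MDSS
    (∀ Φ ξ, M.IsTrajectory σ Φ ξ →
      IsLinearMDSSTrajectory σ M.Red M.A M.XiRed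
        (fun k => M.jumpRed (ξ k (σ.instant (k + 1))) (Φ k)) (fun k t => M.dis (ξ k t))) ∧
    -- state-independent transformed jumps: practical consensus
    (∀ τ : Fin s → Fin s → ℝ,
      σ.TDADTCondition M.Ps (M.rate P γ) (M.Omega σ P (M.upsilon M.XiRed) η₀ χ) τ →
      σ.PiecewiseTDADTCondition M.Ps (M.rate P γ) (M.Omega σ P (M.upsilon M.XiRed) η₀ χ) →
      ∀ Φbar : ℝ, 0 < Φbar → ∃ ε : ℝ, 0 ≤ ε ∧
        ∀ Φred : ∀ k, EuclideanSpace ℝ (M.Red (σ.mode (k + 1))), (∀ k, ‖Φred k‖ ≤ Φbar) →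
        ∀ Φ ξ, M.IsTrajectory σ Φ ξ →
          (∀ k, M.jumpRed (ξ k (σ.instant (k + 1))) (Φ k) = Φred k) →
          M.UltimateDisagreementLE σ ξ ε) ∧
    -- state-dependent (linear) transformed jumps: consensus
    (∀ XiHat : ∀ φ φ', Matrix (M.Red φ) (M.Red φ') ℝ, ∀ τ : Fin s → Fin s → ℝ,
      σ.TDADTCondition M.Ps (M.rate P γ)
        (M.Omega σ P (M.upsilon fun φ φ' => M.XiRed φ φ' + XiHat φ φ') η₀ χ) τ →
      ∀ Φ ξ, M.IsTrajectory σ Φ ξ →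
        (∀ k, M.jumpRed (ξ k (σ.instant (k + 1))) (Φ k) =
          mulE (XiHat (σ.mode (k + 1)) (σ.mode k)) (M.dis (ξ k (σ.instant (k + 1))))) →
        M.UltimateDisagreementLE σ ξ 0) := by
  refine ⟨fun Φ ξ h => OpenMAS.isLinearMDSSTrajectory_dis h, fun τ _ hpw Φbar hΦbar => ?_,
    fun XiHat τ hτ Φ ξ h hjump => ?_⟩
  · exact OpenMAS.practical_consensus_of_bounded_jumps hσ hγs hP hLyap hη₀ hχ hpw hΦbar
  · exact OpenMAS.consensus_of_linear_jumps hσ hγs hP hLyap hη₀ hχ hτ h hjump
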